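/- Notation. Let $F_n$ be the free group on $x_1,\dots,x_n$, with commutators $[x,y]=xyx^{-1}y^{-1}$ and left-normed commutators $[g_1,\dots,g_m]=[\cdots[[g_1,g_2],g_3],\dots,g_m]$. Let $\Gamma_n(1)=F_n$, $\Gamma_n(k+1)=[\Gamma_n(k),F_n]$ be its lower central series, $H=H_1(F_n,\mathbb Z)$ with basis the classes of the $x_i$ and dual basis $x_i^*$ of $H^*$, and $\mathcal L_n(k)=\Gamma_n(k)/\Gamma_n(k+1)$, the degree $k$ part of the free Lie algebra on $H$; write $\iota_k:\mathcal L_n(k)\to H^{\otimes k}$ for the natural embedding (the degree $k$ part of the Lie algebra map into the tensor algebra that is the identity on $H$). Identify $H^*\otimes_{\mathbb Z}\mathcal L_n(k+1)=\mathrm{Hom}_{\mathbb Z}(H,\mathcal L_n(k+1))$. For $k\ge 1$ let $\mathfrak p_n(k)\subset H^*\otimes\mathcal L_n(k+1)$ be the submodule generated by all $x_i^*\otimes[x_{i_1},\dots,x_{i_k},x_i]$ with $1\le i,i_1,\dots,i_k\le n$. For a composition $\alpha=(\alpha_1,\dots,\alpha_n)$ of $k$ (integers $\alpha_j\ge 0$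 with $\sum_j\alpha_j=k$) let $\mathfrak p_n(k,\alpha)\subset\mathfrak p_n(k)$ be the submodule generated by those $x_i^*\otimes[x_{i_1},\dots,x_{i_k},x_i]$, $1\le i\le n$, for which $(i_1,\dots,i_k)$ is a rearrangement of $1^{\alpha_1}2^{\alpha_2}\cdots n^{\alpha_n}$. Let $\mathcal C_n(k)$ be the quotient of $H^{\otimes k}$ by the span of all $a_1\otimes a_2\otimes\cdots\otimes a_k-a_2\otimes\cdots\otimes a_k\otimes a_1$, and $\overline{\mathcal C}_n(k)=\mathcal C_n(k)/\langle x_1^k,\dots,x_n^k\rangle$, where $x_i^k$ is the class of $x_i^{\otimes k}$. The reduced trace $\overline{\mathrm{Tr}}{}_k^P:\mathfrak p_n(k)\to\overline{\mathcal C}_n(k)$ is the restriction to $\mathfrak p_n(k)$ of the composite \[ H^*\otimes\mathcal L_n(k+1)\xrightarrow{\ \mathrm{id}\otimes\iota_{k+1}\ }H^*\otimes H^{\otimes(k+1)}\to H^{\otimes k}\to\mathcal C_n(k)\to\overline{\mathcal C}_n(k), \] where the second map is the contraction $f\otimes a_1\otimes\cdots\otimes a_{k+1}\mapsto f(a_1)\,a_2\otimes\cdots\otimes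 a_{k+1}$ and the last two are the projections. Let $\mathrm P\Sigma_n\subset\mathrm{Aut}\,F_n$ be the group of automorphisms sending each $x_i$ to a conjugate of $x_i$, let $\mathcal A_n(k)$ be the kernel of $\mathrm{Aut}\,F_n\to\mathrm{Aut}(F_n/\Gamma_n(k+1))$, and put $\mathcal P_n(k)=\mathrm P\Sigma_n\cap\mathcal A_n(k)$. The $k$-th Johnson homomorphism $\tau_k^P$ of $\mathrm P\Sigma_n$ is the homomorphism $\mathcal P_n(k)/\mathcal P_n(k+1)\to\mathrm{Hom}_{\mathbb Z}(H,\mathcal L_n(k+1))$ induced by $\sigma\mapsto(x\mapsto x^{-1}\sigma(x))$. Theorem. Let $n\ge 3$, $k\ge 1$, and let $\alpha=(\alpha_1,\dots,\alpha_n)$ be a composition of $k$ with $\alpha_j=1$ for some $1\le j\le n$. Then \[ \mathrm{Ker}\bigl(\overline{\mathrm{Tr}}{}_k^P|_{\mathfrak p_n(k,\alpha)}\bigr)\subset\mathrm{Im}(\tau_k^P). \] -/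

import Mathlib

open scoped TensorProduct commutatorElement

noncomputable section

namespace McCoolJohnson

/-! ## The free group, its lower central series and the graded quotients -/

/-- `Γ_n(k)`, with `Γ_n(1) = F_n` and `Γ_n(k+1) = [Γ_n(k), F_n]` for `k ≥ 1`.
(Mathlib indexes the lower central series from `0`; the value at `k = 0` is never used.) -/
def Gam (n k : ℕ) : Subgroup (FreeGroup (Fin n)) :=
  (⊤ : Subgroup (FreeGroup (Fin n))).lowerCentralSeries (k - 1)

instance Gam_characteristic (n k : ℕ) : (Gam n k).Characteristic := by
  unfold Gam; infer_instance

theorem Gam_one (n : ℕ) : Gam n 1 = ⊤ := rfl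

theorem mem_Gam_one {n : ℕ} (g : FreeGroup (Fin n)) : g ∈ Gam n 1 := Subgroup.mem_top g

theorem Gam_succ (n k : ℕ) (hk : 1 ≤ k) : Gam n (k + 1) = ⁅Gam n k, ⊤⁆ := by
  obtain ⟨m, rfl⟩ : ∃ m, k = m + 1 := ⟨k - 1, by omega⟩
  rfl

theorem Gam_antitone (n : ℕ) : Antitone (Gam n) := fun _ _ h =>
  Subgroup.lowerCentralSeries_antitone _ (Nat.sub_le_sub_right h 1)

theorem comm_mem_Gam {n k : ℕ} {x : FreeGroup (Fin n)} (hx : x ∈ Gam n k)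
    (y : FreeGroup (Fin n)) : ⁅x, y⁆ ∈ Gam n (k + 1) := by
  rcases Nat.eq_zero_or_pos k with rfl | hk
  · exact Subgroup.mem_top _
  · rw [Gam_succ n k hk]
    exact Subgroup.commutator_mem_commutator hx (Subgroup.mem_top y)

/-- `Γ_n(k) / Γ_n(k+1)`, written multiplicatively. -/
abbrev LMul (n k : ℕ) : Type := Gam n k ⧸ (Gam n (k + 1)).subgroupOf (Gam n k)

instance LMul_commGroup (n k : ℕ) : CommGroup (LMul n k) :=
  { (inferInstance : Group (LMul n k)) with
    mul_comm := by
      intro a b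
      induction a using QuotientGroup.induction_on with | _ a =>
      induction b using QuotientGroup.induction_on with | _ b =>
      rw [← QuotientGroup.mk_mul, ← QuotientGroup.mk_mul, QuotientGroup.eq,
        Subgroup.mem_subgroupOf]
      have h := comm_mem_Gam (Subgroup.inv_mem _ b.2) (a : FreeGroup (Fin n))⁻¹
      convert h using 1
      simp [commutatorElement_def, mul_assoc] }

/-- `𝓛_n(k) = Γ_n(k) / Γ_n(k+1)`, written additively: the degree `k` part of the free Lie algebra
on `H`, realised as the graded Lie algebra of the lower central series of `F_n`. -/
abbrev L (n k : ℕ) : Type := Additive (LMul n k)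

/-- The class in `𝓛_n(k)` of an element of `Γ_n(k)`. -/
def cls (n k : ℕ) (g : FreeGroup (Fin n)) (hg : g ∈ Gam n k) : L n k :=
  Additive.ofMul (QuotientGroup.mk (⟨g, hg⟩ : Gam n k))

theorem cls_eq_iff {n k : ℕ} {g h : FreeGroup (Fin n)} (hg : g ∈ Gam n k) (hh : h ∈ Gam n k) :
    cls n k g hg = cls n k h hh ↔ g⁻¹ * h ∈ Gam n (k + 1) := by
  unfold cls
  rw [Additive.ofMul.injective.eq_iff, QuotientGroup.eq, Subgroup.mem_subgroupOf]
  rfl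

theorem cls_mul {n k : ℕ} {g h : FreeGroup (Fin n)} (hg : g ∈ Gam n k) (hh : h ∈ Gam n k) :
    cls n k (g * h) (Subgroup.mul_mem _ hg hh) = cls n k g hg + cls n k h hh := rfl

/-- The left-normed commutator `[x_{w 0}, x_{w 1}, …, x_{w m}]` in `F_n`, where
`[x, y] = x y x⁻¹ y⁻¹`. -/
def leftNormed (n : ℕ) : (m : ℕ) → (Fin (m + 1) → Fin n) → FreeGroup (Fin n)
  | 0, w => FreeGroup.of (w 0)
  | m + 1, w => ⁅leftNormed n m (Fin.init w), FreeGroup.of (w (Fin.last (m + 1)))⁆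

theorem leftNormed_mem (n : ℕ) : ∀ (m : ℕ) (w : Fin (m + 1) → Fin n),
    leftNormed n m w ∈ Gam n (m + 1)
  | 0, _ => Subgroup.mem_top _
  | m + 1, w => comm_mem_Gam (leftNormed_mem n m (Fin.init w)) _

/-- The left-normed bracket `[x_{w 0}, …, x_{w m}] ∈ 𝓛_n(m+1)`. -/
def bracket (n m : ℕ) (w : Fin (m + 1) → Fin n) : L n (m + 1) :=
  cls n (m + 1) (leftNormed n m w) (leftNormed_mem n m w)

/-! ## `H`, its dual and its tensor powers -/

/-- `H = H_1(F_n, ℤ)`, the abelianization of `F_n`, written additively. -/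
abbrev H (n : ℕ) : Type := Additive (Abelianization (FreeGroup (Fin n)))

/-- The basis element `x_i ∈ H`. -/
def x {n : ℕ} (i : Fin n) : H n := Additive.ofMul (Abelianization.of (FreeGroup.of i))

/-- The homomorphism `H → ℤ` with `x_i ↦ 1` and `x_j ↦ 0` for `j ≠ i`, written multiplicatively. -/
def xDualMul {n : ℕ} (i : Fin n) : Abelianization (FreeGroup (Fin n)) →* Multiplicative ℤ :=
  Abelianization.lift (FreeGroup.lift fun j : Fin n =>
    Multiplicative.ofAdd (if j = i then (1 : ℤ) else 0))

/-- The dual basis element `x_i^* ∈ H^*`. -/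
def xDual {n : ℕ} (i : Fin n) : Module.Dual ℤ (H n) :=
  (MonoidHom.toAdditiveLeft (xDualMul i)).toIntLinearMap

theorem xDual_x {n : ℕ} (i j : Fin n) : xDual i (x j) = if j = i then 1 else 0 := by
  show Multiplicative.toAdd (xDualMul i (Abelianization.of (FreeGroup.of j))) = _
  rw [xDualMul, Abelianization.lift_apply_of, FreeGroup.lift_apply_of]
  rfl

/-- `Hom(H, 𝓛_n(k+1)) = H^* ⊗ 𝓛_n(k+1)`, the degree `k` derivations of the free Lie algebra. -/
abbrev DerL (n k : ℕ) : Type := H n →ₗ[ℤ] L n (k + 1)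

/-- `x_i^* ⊗ u` as an element of `Hom(H, 𝓛_n(k+1))`, i.e. `h ↦ x_i^*(h) u`. -/
def elem {n k : ℕ} (i : Fin n) (u : L n (k + 1)) : DerL n k := (xDual i).smulRight u

/-! ## The natural embedding of `𝓛_n(k)` in `H^{⊗k}` -/

/-- The tensor algebra `T(H)`. -/
abbrev T (n : ℕ) : Type := TensorAlgebra ℤ (H n)

/-- `1 + x_i t ∈ T(H)[[t]]`. -/
def magnusGen {n : ℕ} (i : Fin n) : PowerSeries (T n) :=
  1 + PowerSeries.C (TensorAlgebra.ι ℤ (x i)) * PowerSeries.X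

theorem magnusGen_const {n : ℕ} (i : Fin n) :
    PowerSeries.constantCoeff (magnusGen i) = ((1 : (T n)ˣ) : T n) := by
  simp [magnusGen]

/-- The Magnus expansion `F_n → T(H)[[t]]ˣ`, `x_i ↦ 1 + x_i t`. -/
def magnus (n : ℕ) : FreeGroup (Fin n) →* (PowerSeries (T n))ˣ :=
  FreeGroup.lift fun i =>
    { val := magnusGen i
      inv := PowerSeries.invOfUnit (magnusGen i) 1
      val_inv := PowerSeries.mul_invOfUnit _ _ (magnusGen_const i)
      inv_val := PowerSeries.invOfUnit_mul _ _ (magnusGen_const i) }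

theorem order_mul_right {R : Type*} [Ring R] {k : ℕ∞} {a : PowerSeries R} (h : k ≤ a.order)
    (b : PowerSeries R) : k ≤ (a * b).order :=
  le_trans (le_trans h le_self_add) (PowerSeries.le_order_mul a b)

theorem order_add' {R : Type*} [Ring R] {k : ℕ∞} {a b : PowerSeries R} (ha : k ≤ a.order)
    (hb : k ≤ b.order) : k ≤ (a + b).order :=
  le_trans (le_min ha hb) (PowerSeries.min_order_le_order_add a b)

theorem order_neg' {R : Type*} [Ring R] {k : ℕ∞} {a : PowerSeries R} (ha : k ≤ a.order) :
    k ≤ (-a).order :=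
  le_trans ha (PowerSeries.le_order _ _ fun i hi => by
    rw [map_neg, PowerSeries.coeff_of_lt_order i hi, neg_zero])

/-- The units of the form `1 + (terms of order ≥ k)`. -/
def congrUnits (R : Type*) [Ring R] (k : ℕ) : Subgroup (PowerSeries R)ˣ where
  carrier := {u | (k : ℕ∞) ≤ ((u : PowerSeries R) - 1).order}
  one_mem' := by simp
  mul_mem' := by
    intro u v hu hv
    have : ((u * v : (PowerSeries R)ˣ) : PowerSeries R) - 1
        = ((u : PowerSeries R) - 1) * v + ((v : PowerSeries R) - 1) := by
      push_cast; noncomm_ring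
    simp only [Set.mem_ofPred_eq] at *
    rw [this]
    exact order_add' (order_mul_right hu _) hv
  inv_mem' := by
    intro u hu
    have : ((u⁻¹ : (PowerSeries R)ˣ) : PowerSeries R) - 1
        = -(((u : PowerSeries R) - 1) * ((u⁻¹ : (PowerSeries R)ˣ) : PowerSeries R)) := by
      rw [sub_mul, Units.mul_inv]; noncomm_ring
    simp only [Set.mem_ofPred_eq] at *
    rw [this]
    exact order_neg' (order_mul_right hu _)

theorem mem_congrUnits {R : Type*} [Ring R] {k : ℕ} {u : (PowerSeries R)ˣ} :
    u ∈ congrUnits R k ↔ (k : ℕ∞) ≤ ((u : PowerSeries R) - 1).order := Iff.rfl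

theorem units_comm_sub_one {A : Type*} [Ring A] (u v : Aˣ) :
    ((⁅u, v⁆ : Aˣ) : A) - 1 =
      (((u : A) - 1) * ((v : A) - 1) - ((v : A) - 1) * ((u : A) - 1)) *
        ((u⁻¹ * v⁻¹ : Aˣ) : A) := by
  have h1 : ((u : A) - 1) * ((v : A) - 1) - ((v : A) - 1) * ((u : A) - 1) = u * v - v * u := by
    noncomm_ring
  have h2 : ((v : A) * u) * ((u⁻¹ * v⁻¹ : Aˣ) : A) = 1 := by
    rw [← Units.val_mul, ← Units.val_mul]; simp
  rw [h1, sub_mul, h2, commutatorElement_def]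
  push_cast
  simp [mul_assoc]

theorem comm_mem_congrUnits {R : Type*} [Ring R] {k l : ℕ} {u v : (PowerSeries R)ˣ}
    (hu : u ∈ congrUnits R k) (hv : v ∈ congrUnits R l) : ⁅u, v⁆ ∈ congrUnits R (k + l) := by
  rw [mem_congrUnits] at *
  rw [units_comm_sub_one, Nat.cast_add]
  refine order_mul_right ?_ _
  rw [sub_eq_add_neg]
  refine order_add' (le_trans (add_le_add hu hv) (PowerSeries.le_order_mul _ _))
    (order_neg' (le_trans ?_ (PowerSeries.le_order_mul _ _)))
  rw [add_comm]
  exact add_le_add hv hu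

theorem magnus_mem_one {n : ℕ} (g : FreeGroup (Fin n)) : magnus n g ∈ congrUnits (T n) 1 := by
  induction g using FreeGroup.induction_on with
  | C1 => rw [map_one]; exact Subgroup.one_mem _
  | of i =>
    rw [mem_congrUnits]
    refine PowerSeries.nat_le_order _ _ fun j hj => ?_
    obtain rfl : j = 0 := by omega
    simp [magnus, magnusGen]
  | inv_of i h => rw [map_inv]; exact Subgroup.inv_mem _ h
  | mul a b ha hb => rw [map_mul]; exact Subgroup.mul_mem _ ha hb

theorem magnus_mem {n : ℕ} : ∀ (k : ℕ) (g : FreeGroup (Fin n)), g ∈ Gam n (k + 1) →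
    magnus n g ∈ congrUnits (T n) (k + 1)
  | 0, g, _ => magnus_mem_one g
  | k + 1, g, hg => by
    have : Gam n (k + 1 + 1) ≤ (congrUnits (T n) (k + 1 + 1)).comap (magnus n) := by
      rw [Gam_succ n (k + 1) (by omega), Subgroup.commutator_le]
      intro a ha b _
      rw [Subgroup.mem_comap, map_commutatorElement]
      exact comm_mem_congrUnits (magnus_mem k a ha) (magnus_mem_one b)
    exact this hg

/-- The coefficient of `t^k` of the Magnus expansion of `g`. -/
def magnusCoeff (n k : ℕ) (g : FreeGroup (Fin n)) : T n :=
  PowerSeries.coeff k (magnus n g : PowerSeries (T n))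

theorem magnusCoeff_mul {n k : ℕ} {g h : FreeGroup (Fin n)} (hg : g ∈ Gam n (k + 1))
    (hh : h ∈ Gam n (k + 1)) :
    magnusCoeff n (k + 1) (g * h) = magnusCoeff n (k + 1) g + magnusCoeff n (k + 1) h := by
  have hu := magnus_mem k g hg
  have hv := magnus_mem k h hh
  rw [mem_congrUnits] at hu hv
  unfold magnusCoeff
  rw [map_mul, Units.val_mul]
  set a := (magnus n g : PowerSeries (T n))
  set b := (magnus n h : PowerSeries (T n))
  have h0 : PowerSeries.coeff (k + 1) ((a - 1) * (b - 1)) = 0 := by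
    apply PowerSeries.coeff_of_lt_order
    refine lt_of_lt_of_le ?_ (le_trans (add_le_add hu hv) (PowerSeries.le_order_mul _ _))
    norm_cast
    omega
  have h1 : PowerSeries.coeff (k + 1) (1 : PowerSeries (T n)) = 0 := by
    simp [PowerSeries.coeff_one]
  have h2 : a * b = (a - 1) * (b - 1) + a + b - 1 := by noncomm_ring
  rw [h2, map_sub, map_add, map_add, h0, h1]
  simp

theorem magnusCoeff_eq_zero {n k : ℕ} {g : FreeGroup (Fin n)} (hg : g ∈ Gam n (k + 2)) :
    magnusCoeff n (k + 1) g = 0 := by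
  have hu := magnus_mem (k + 1) g hg
  rw [mem_congrUnits] at hu
  have h0 : PowerSeries.coeff (k + 1) ((magnus n g : PowerSeries (T n)) - 1) = 0 := by
    apply PowerSeries.coeff_of_lt_order
    refine lt_of_lt_of_le ?_ hu
    norm_cast
    omega
  rw [map_sub, PowerSeries.coeff_one, if_neg (by omega), sub_zero] at h0
  exact h0

/-- `𝓛_n(k+1) → T(H)`: the class of `g` goes to the coefficient of `t^{k+1}` in its Magnus
expansion. By `iotaT_generator` and `iotaT_commutator` below this is the restriction to degree
`k+1` of the natural embedding of Lie algebras `𝓛_n → T(H)` which is the identity on `H`. -/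
def iotaT (n k : ℕ) : L n (k + 1) →ₗ[ℤ] T n :=
  (MonoidHom.toAdditiveLeft (QuotientGroup.lift _
    ({ toFun := fun g => Multiplicative.ofAdd (magnusCoeff n (k + 1) g)
       map_one' := by
        rw [← ofAdd_zero]
        exact congrArg _ (magnusCoeff_eq_zero (Subgroup.one_mem _))
       map_mul' := fun g h => by
        rw [← ofAdd_add]
        exact congrArg _ (magnusCoeff_mul g.2 h.2) } :
      Gam n (k + 1) →* Multiplicative (T n))
    (fun _ hg => congrArg Multiplicative.ofAdd
      (magnusCoeff_eq_zero (Subgroup.mem_subgroupOf.mp hg))))).toIntLinearMap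

theorem iotaT_cls {n k : ℕ} (g : FreeGroup (Fin n)) (hg : g ∈ Gam n (k + 1)) :
    iotaT n k (cls n (k + 1) g hg) = magnusCoeff n (k + 1) g := rfl

theorem iotaT_generator {n : ℕ} (i : Fin n) :
    iotaT n 0 (cls n 1 (FreeGroup.of i) (mem_Gam_one _)) = TensorAlgebra.ι ℤ (x i) := by
  rw [iotaT_cls]
  simp [magnusCoeff, magnus, magnusGen, PowerSeries.coeff_one]

theorem coeff_mul_of_order {R : Type*} [Ring R] {p q : ℕ} {a b : PowerSeries R}
    (ha : (p : ℕ∞) ≤ a.order) (hb : (q : ℕ∞) ≤ b.order) :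
    PowerSeries.coeff (p + q) (a * b) = PowerSeries.coeff p a * PowerSeries.coeff q b := by
  rw [PowerSeries.coeff_mul, Finset.sum_eq_single (p, q)]
  · rintro ⟨i, j⟩ hij hne
    rw [Finset.HasAntidiagonal.mem_antidiagonal] at hij
    simp only at hij
    rcases lt_or_ge i p with h | h
    · rw [PowerSeries.coeff_of_lt_order i (lt_of_lt_of_le (by exact_mod_cast h) ha), zero_mul]
    · have h' : j < q := by
        rcases lt_or_ge j q with h' | h'
        · exact h'
        · exact absurd (Prod.ext (by simp only; omega) (by simp only; omega)) hne
      rw [PowerSeries.coeff_of_lt_order j (lt_of_lt_of_le (by exact_mod_cast h') hb), mul_zero]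
  · intro h
    exact absurd (Finset.HasAntidiagonal.mem_antidiagonal.mpr (rfl : (p, q).1 + (p, q).2 = p + q)) h

theorem iotaT_commutator {n k : ℕ} (g h : FreeGroup (Fin n)) (hg : g ∈ Gam n (k + 1)) :
    iotaT n (k + 1) (cls n (k + 2) ⁅g, h⁆ (comm_mem_Gam hg h)) =
      iotaT n k (cls n (k + 1) g hg) * iotaT n 0 (cls n 1 h (mem_Gam_one _)) -
      iotaT n 0 (cls n 1 h (mem_Gam_one _)) * iotaT n k (cls n (k + 1) g hg) := by
  have hu := magnus_mem k g hg
  have hv := magnus_mem_one h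
  rw [mem_congrUnits] at hu hv
  rw [iotaT_cls, iotaT_cls, iotaT_cls]
  have key : ∀ (m : ℕ) (f : FreeGroup (Fin n)), magnusCoeff n (m + 1) f =
      PowerSeries.coeff (m + 1) ((magnus n f : PowerSeries (T n)) - 1) := by
    intro m f
    rw [map_sub, PowerSeries.coeff_one, if_neg (by omega), sub_zero]
    rfl
  rw [key, key, key, map_commutatorElement, units_comm_sub_one]
  set a := (magnus n g : PowerSeries (T n)) - 1
  set b := (magnus n h : PowerSeries (T n)) - 1
  set w := (magnus n g)⁻¹ * (magnus n h)⁻¹ with hw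
  have hab : (((k + 1) + 1 : ℕ) : ℕ∞) ≤ (a * b - b * a).order := by
    rw [Nat.cast_add (k + 1) 1, sub_eq_add_neg]
    refine order_add' (le_trans (add_le_add hu hv) (PowerSeries.le_order_mul _ _))
      (order_neg' (le_trans ?_ (PowerSeries.le_order_mul _ _)))
    rw [add_comm]
    exact add_le_add hv hu
  have h0 : PowerSeries.coeff 0 (w : PowerSeries (T n)) = 1 := by
    have hw' : w ∈ congrUnits (T n) 1 := by
      rw [hw, ← map_inv, ← map_inv, ← map_mul]
      exact magnus_mem_one _
    rw [mem_congrUnits] at hw'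
    have h1 := PowerSeries.coeff_of_lt_order 0
      (lt_of_lt_of_le (by norm_num) hw' : ((0 : ℕ) : ℕ∞) < _)
    rw [map_sub, sub_eq_zero] at h1
    rw [h1]
    simp
  have h1 := coeff_mul_of_order (q := 0) (b := (w : PowerSeries (T n))) hab (by simp)
  rw [h0, mul_one] at h1
  have h2 := coeff_mul_of_order hu hv
  have h3 := coeff_mul_of_order hv hu
  rw [Nat.add_comm 1 (k + 1)] at h3
  refine Eq.trans h1 ?_
  rw [map_sub, h2, h3]

/-- `ι_{k+1} : 𝓛_n(k+1) → H^{⊗(k+1)}`, the degree `k+1` part of `𝓛_n → T(H) = ⨁ H^{⊗m}`. -/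
def iota (n k : ℕ) : L n (k + 1) →ₗ[ℤ] ⨂[ℤ]^(k + 1) (H n) :=
  DirectSum.component ℤ ℕ (fun m => ⨂[ℤ]^m (H n)) (k + 1) ∘ₗ
    TensorAlgebra.toDirectSum.toLinearMap ∘ₗ iotaT n k

/-! ## The trace maps -/

/-- Contraction of the first tensor factor with `x_i^*`:
`a_1 ⊗ ⋯ ⊗ a_{k+1} ↦ x_i^*(a_1) a_2 ⊗ ⋯ ⊗ a_{k+1}`. -/
def contract (n k : ℕ) (i : Fin n) : (⨂[ℤ]^(k + 1) (H n)) →ₗ[ℤ] ⨂[ℤ]^k (H n) :=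
  PiTensorProduct.lift
    (LinearMap.uncurryLeft (M := fun _ : Fin (k + 1) => H n)
      ((xDual i).smulRight (PiTensorProduct.tprod ℤ (s := fun _ : Fin k => H n))))

/-- The contraction map `Φ^k : H^* ⊗ 𝓛_n(k+1) → H^{⊗k}`; an element `f` of `Hom(H, 𝓛_n(k+1))`
is `∑ i, x_i^* ⊗ f(x_i)`. -/
def Phi (n k : ℕ) : DerL n k →ₗ[ℤ] ⨂[ℤ]^k (H n) :=
  ∑ i : Fin n, contract n k i ∘ₗ iota n k ∘ₗ LinearMap.applyₗ (x i)

/-- The span of the `a_1 ⊗ a_2 ⊗ ⋯ ⊗ a_k - a_2 ⊗ ⋯ ⊗ a_k ⊗ a_1`. -/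
def cyclicRel (n k : ℕ) : Submodule ℤ (⨂[ℤ]^k (H n)) :=
  Submodule.span ℤ {z | ∃ a : Fin k → H n,
    z = PiTensorProduct.tprod ℤ a - PiTensorProduct.tprod ℤ (fun l => a (finRotate k l))}

/-- `𝓒_n(k)`, the cyclic coinvariants of `H^{⊗k}`. -/
abbrev C (n k : ℕ) : Type := (⨂[ℤ]^k (H n)) ⧸ cyclicRel n k

/-- The trace map `Tr_k = ϖ^k ∘ Φ^k`. -/
def Tr (n k : ℕ) : DerL n k →ₗ[ℤ] C n k := (cyclicRel n k).mkQ ∘ₗ Phi n k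

/-- The span of `x_1^k, …, x_n^k` in `𝓒_n(k)`. -/
def powSpan (n k : ℕ) : Submodule ℤ (C n k) :=
  Submodule.span ℤ
    (Set.range fun i : Fin n => (cyclicRel n k).mkQ (PiTensorProduct.tprod ℤ fun _ => x i))

/-- `𝓒_n(k) / ⟨x_1^k, …, x_n^k⟩`. -/
abbrev CBar (n k : ℕ) : Type := C n k ⧸ powSpan n k

/-! ## The modules `𝔭_n(k)` and `𝔭_n(k, α)` -/

/-- `x_i^* ⊗ [x_{w 1}, …, x_{w k}, x_i]`. -/
def pGen {n k : ℕ} (i : Fin n) (w : Fin k → Fin n) : DerL n k :=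
  elem i (bracket n k (Fin.snoc (α := fun _ => Fin n) w i))

/-- `𝔭_n(k)`, the submodule generated by all `x_i^* ⊗ [x_{w 1}, …, x_{w k}, x_i]`. -/
def p (n k : ℕ) : Submodule ℤ (DerL n k) :=
  Submodule.span ℤ {X | ∃ (i : Fin n) (w : Fin k → Fin n), X = pGen i w}

theorem pGen_mem {n k : ℕ} (i : Fin n) (w : Fin k → Fin n) : pGen i w ∈ p n k :=
  Submodule.subset_span ⟨i, w, rfl⟩

/-- The words `w` which are rearrangements of `1^{α_1} 2^{α_2} ⋯ n^{α_n}`. -/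
def perms {n : ℕ} (k : ℕ) (α : Fin n → ℕ) : Set (Fin k → Fin n) :=
  {w | ∀ j : Fin n, (Finset.univ.filter fun l => w l = j).card = α j}

/-- `𝔭_n(k, α)`, the submodule of `𝔭_n(k)` generated by the `x_i^* ⊗ [x_{w 1}, …, x_{w k}, x_i]`
with `w` a rearrangement of `1^{α_1} ⋯ n^{α_n}`. -/
def pAlpha (n k : ℕ) (α : Fin n → ℕ) : Submodule ℤ (p n k) :=
  Submodule.span ℤ {X | ∃ (i : Fin n) (w : Fin k → Fin n), w ∈ perms k α ∧
    X = ⟨pGen i w, pGen_mem i w⟩}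

/-- The reduced trace map `𝔭_n(k) → 𝓒_n(k) / ⟨x_1^k, …, x_n^k⟩`. -/
def trBarP (n k : ℕ) : p n k →ₗ[ℤ] CBar n k :=
  (powSpan n k).mkQ ∘ₗ (Tr n k).domRestrict (p n k)

/-! ## Basis-conjugating automorphisms and the Johnson homomorphisms -/

/-- `𝓐_n(k)`, the kernel of the action of `Aut F_n` on `F_n / Γ_n(k+1)`. -/
def A (n k : ℕ) : Subgroup (MulAut (FreeGroup (Fin n))) where
  carrier := {σ | ∀ g : FreeGroup (Fin n), g⁻¹ * σ g ∈ Gam n (k + 1)}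
  one_mem' := fun g => by simp
  mul_mem' := by
    intro σ τ hσ hτ g
    have := Subgroup.mul_mem _ (hτ g) (hσ (τ g))
    simpa [mul_assoc] using this
  inv_mem' := by
    intro σ hσ g
    have := Subgroup.inv_mem _ (hσ (σ⁻¹ g))
    simpa using this

theorem A_antitone (n : ℕ) : Antitone (A n) := fun _ _ h _ hσ g =>
  Gam_antitone n (Nat.succ_le_succ h) (hσ g)

instance A_normal (n k : ℕ) : (A n k).Normal where
  conj_mem := by
    intro σ hσ τ g
    have h := hσ (τ⁻¹ g)
    have h2 : τ ((τ⁻¹ g)⁻¹ * σ (τ⁻¹ g)) ∈ Gam n (k + 1) := by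
      have := (Subgroup.characteristic_iff_map_eq.mp (Gam_characteristic n (k + 1))) τ
      rw [← this]
      exact Subgroup.mem_map_of_mem _ h
    simpa using h2

/-- `PΣ_n`, the group of automorphisms sending each `x_i` to a conjugate of `x_i`. -/
def PSigma (n : ℕ) : Subgroup (MulAut (FreeGroup (Fin n))) where
  carrier := {σ | ∀ i : Fin n, IsConj (FreeGroup.of i) (σ (FreeGroup.of i))}
  one_mem' := fun i => IsConj.refl _
  mul_mem' := by
    intro σ τ hσ hτ i
    exact (hσ i).trans (σ.toMonoidHom.map_isConj (hτ i))
  inv_mem' := by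
    intro σ hσ i
    have h : IsConj _ _ := (σ⁻¹).toMonoidHom.map_isConj (hσ i)
    simpa using h.symm

/-- `𝓟_n(k) = PΣ_n ∩ 𝓐_n(k)`. -/
def P (n k : ℕ) : Subgroup (MulAut (FreeGroup (Fin n))) := PSigma n ⊓ A n k

theorem P_le_A (n k : ℕ) : P n k ≤ A n k := inf_le_right

instance P_normal (n k : ℕ) : ((P n (k + 1)).subgroupOf (P n k)).Normal where
  conj_mem := by
    intro a ha b
    rw [Subgroup.mem_subgroupOf] at *
    exact ⟨Subgroup.mul_mem _ (Subgroup.mul_mem _ b.2.1 ha.1) (Subgroup.inv_mem _ b.2.1),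
      (A_normal n (k + 1)).conj_mem _ ha.2 _⟩

/-- `gr^k(𝓟_n) = 𝓟_n(k) / 𝓟_n(k+1)`. -/
abbrev grP (n k : ℕ) : Type := P n k ⧸ (P n (k + 1)).subgroupOf (P n k)

/-- For `σ ∈ 𝓐_n(k)`, the homomorphism `F_n → 𝓛_n(k+1)`, `g ↦ g⁻¹ g^σ`. -/
def johnsonAux {n k : ℕ} (σ : A n k) : FreeGroup (Fin n) →* LMul n (k + 1) where
  toFun g := QuotientGroup.mk ⟨g⁻¹ * (σ : MulAut (FreeGroup (Fin n))) g, σ.2 g⟩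
  map_one' := by
    refine (QuotientGroup.eq_one_iff _).mpr ?_
    rw [Subgroup.mem_subgroupOf]
    simp
  map_mul' g h := by
    rw [← QuotientGroup.mk_mul, QuotientGroup.eq, Subgroup.mem_subgroupOf]
    set s := (σ : MulAut (FreeGroup (Fin n)))
    have h1 := comm_mem_Gam (Subgroup.inv_mem _ (σ.2 g)) h
    have h2 := (inferInstance : (Gam n (k + 1 + 1)).Normal).conj_mem _ h1 (s h)⁻¹
    convert h2 using 1
    simp [commutatorElement_def, mul_assoc, s]

/-- `τ̃_k(σ) ∈ Hom(H, 𝓛_n(k+1))`, sending the class of `g ∈ F_n` to that of `g⁻¹ g^σ`. -/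
def johnsonElem {n k : ℕ} (σ : A n k) : DerL n k :=
  (MonoidHom.toAdditive (Abelianization.lift (johnsonAux σ))).toIntLinearMap

theorem johnsonElem_apply {n k : ℕ} (σ : A n k) (g : FreeGroup (Fin n)) :
    johnsonElem σ (Additive.ofMul (Abelianization.of g)) =
      cls n (k + 1) (g⁻¹ * (σ : MulAut (FreeGroup (Fin n))) g) (σ.2 g) := rfl

theorem DerL_ext {n k : ℕ} {f f' : DerL n k}
    (h : ∀ g, f (Additive.ofMul (Abelianization.of g)) =
      f' (Additive.ofMul (Abelianization.of g))) : f = f' := by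
  refine LinearMap.ext fun y => ?_
  obtain ⟨g, hg⟩ := QuotientGroup.mk_surjective (Additive.toMul y)
  have : y = Additive.ofMul (Abelianization.of g) := (congrArg Additive.ofMul hg).symm
  rw [this]
  exact h g

/-- `[Γ(m), Γ(2)] ⊆ Γ(m+2)`. -/
theorem comm_Gam_two (n m : ℕ) (hm : 1 ≤ m) : ⁅Gam n 2, Gam n m⁆ ≤ Gam n (m + 2) := by
  let f := QuotientGroup.mk' (Gam n (m + 2))
  have hs : Function.Surjective f := QuotientGroup.mk'_surjective _
  have hbot : (Gam n (m + 2)).map f = ⊥ := by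
    rw [Subgroup.map_eq_bot_iff, QuotientGroup.ker_mk']
  let t : Subgroup (FreeGroup (Fin n)) := ⊤
  let u : Subgroup (FreeGroup (Fin n) ⧸ Gam n (m + 2)) := ⊤
  have e : Gam n (m + 2) = ⁅⁅Gam n m, t⁆, t⁆ := by
    rw [Gam_succ n (m + 1) (by omega), Gam_succ n m hm]
  have ht : t.map f = u := Subgroup.map_top_of_surjective f hs
  have h1 : ⁅⁅(Gam n m).map f, u⁆, u⁆ = ⊥ := by
    have h0 := congrArg (Subgroup.map f) e
    rw [hbot, Subgroup.map_commutator, Subgroup.map_commutator, ht] at h0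
    exact h0.symm
  have h2 : ⁅⁅u, (Gam n m).map f⁆, u⁆ = ⊥ := by
    rw [Subgroup.commutator_comm u]; exact h1
  have h3 := Subgroup.commutator_commutator_eq_bot_of_rotate h2 h1
  have h4 : (⁅Gam n 2, Gam n m⁆).map f = ⊥ := by
    rw [Gam_succ n 1 le_rfl, Gam_one, Subgroup.map_commutator, Subgroup.map_commutator,
      Subgroup.map_top_of_surjective f hs]
    exact h3
  rw [Subgroup.map_eq_bot_iff, QuotientGroup.ker_mk'] at h4
  exact h4

/-- Elements of `𝓐_n(1)` act trivially on each `Γ_n(m) / Γ_n(m+1)`. -/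
theorem act_trivial {n : ℕ} {σ : MulAut (FreeGroup (Fin n))} (hσ : σ ∈ A n 1) :
    ∀ (m : ℕ) (y : FreeGroup (Fin n)), y ∈ Gam n (m + 1) → y⁻¹ * σ y ∈ Gam n (m + 2)
  | 0, y, _ => hσ y
  | m + 1, y, hy => by
    let f := QuotientGroup.mk' (Gam n (m + 3))
    have key : Gam n (m + 2) ≤ f.eqLocus (f.comp σ.toMonoidHom) := by
      rw [Gam_succ n (m + 1) (by omega), Subgroup.commutator_le]
      intro a ha b _
      have hc := act_trivial hσ m a ha
      have hd := hσ b
      obtain ⟨c, hc'⟩ : ∃ c, c = a⁻¹ * σ a := ⟨_, rfl⟩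
      obtain ⟨d, hd'⟩ : ∃ d, d = b⁻¹ * σ b := ⟨_, rfl⟩
      rw [← hc'] at hc
      rw [← hd'] at hd
      have ea : σ a = a * c := by rw [hc']; simp
      have eb : σ b = b * d := by rw [hd']; simp
      have comm0 : ∀ u v : FreeGroup (Fin n), ⁅u, v⁆ ∈ Gam n (m + 3) → f u * f v = f v * f u := by
        intro u v huv
        rw [← commutatorElement_eq_one_iff_mul_comm, ← map_commutatorElement]
        exact (QuotientGroup.eq_one_iff _).mpr huv
      have c1 : ∀ v, f c * f v = f v * f c := fun v => comm0 c v (comm_mem_Gam hc v)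
      have c2 : f d * f a = f a * f d := comm0 d a
        (comm_Gam_two n (m + 1) (by omega) (Subgroup.commutator_mem_commutator hd ha))
      show f ⁅a, b⁆ = f (σ ⁅a, b⁆)
      rw [map_commutatorElement σ, ea, eb, map_commutatorElement, map_commutatorElement,
        map_mul, map_mul]
      have c3 : ⁅f a * f c, f b * f d⁆ = ⁅f a, f b * f d⁆ := by
        have : f c * (f b * f d) = (f b * f d) * f c := by rw [← map_mul]; exact c1 _
        simp only [commutatorElement_def, mul_inv_rev]
        calc f a * f c * (f b * f d) * ((f c)⁻¹ * (f a)⁻¹) * ((f d)⁻¹ * (f b)⁻¹)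
            = f a * (f c * (f b * f d)) * (f c)⁻¹ * (f a)⁻¹ * ((f d)⁻¹ * (f b)⁻¹) := by
              simp only [mul_assoc]
          _ = _ := by rw [this]; simp [mul_assoc]
      rw [c3]
      have c4 : f d * (f a)⁻¹ = (f a)⁻¹ * f d := by
        rw [eq_inv_mul_iff_mul_eq, ← mul_assoc, ← c2]; simp
      simp only [commutatorElement_def, mul_inv_rev]
      calc f a * f b * (f a)⁻¹ * (f b)⁻¹
          = f a * f b * ((f a)⁻¹ * f d) * ((f d)⁻¹ * (f b)⁻¹) := by simp [mul_assoc]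
        _ = _ := by rw [← c4]; simp [mul_assoc]
    exact QuotientGroup.eq.mp (key hy)

theorem johnsonElem_mul {n k : ℕ} (hk : 1 ≤ k) (σ τ : A n k) :
    johnsonElem (σ * τ) = johnsonElem σ + johnsonElem τ := by
  refine DerL_ext fun g => ?_
  rw [LinearMap.add_apply, johnsonElem_apply, johnsonElem_apply, johnsonElem_apply, ← cls_mul,
    cls_eq_iff]
  have h := act_trivial (A_antitone n hk σ.2) k _ (τ.2 g)
  have h' := Subgroup.inv_mem _ h
  convert h' using 1
  simp [mul_assoc]

theorem johnsonElem_eq_zero {n k : ℕ} (σ : A n k)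
    (hσ : (σ : MulAut (FreeGroup (Fin n))) ∈ A n (k + 1)) : johnsonElem σ = 0 := by
  refine DerL_ext fun g => ?_
  rw [johnsonElem_apply]
  refine (cls_eq_iff _ (Subgroup.one_mem _)).mpr ?_
  have h' := Subgroup.inv_mem _ (hσ g)
  simpa using h'

/-- The homomorphism `τ̃_k : 𝓐_n(k) → Hom(H, 𝓛_n(k+1))`. -/
def tauTilde (n k : ℕ) (hk : 1 ≤ k) : A n k →* Multiplicative (DerL n k) :=
  MonoidHom.mk' (fun σ => Multiplicative.ofAdd (johnsonElem σ)) fun σ τ => by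
    rw [johnsonElem_mul hk, ofAdd_add]

/-- The `k`-th Johnson homomorphism `τ_k^P` of `PΣ_n`, induced by the restriction of `τ̃_k` to
`𝓟_n(k)` on `gr^k(𝓟_n) = 𝓟_n(k) / 𝓟_n(k+1)`. -/
def tauP (n k : ℕ) (hk : 1 ≤ k) : grP n k →* Multiplicative (DerL n k) :=
  QuotientGroup.lift _
    ((tauTilde n k hk).comp (Subgroup.inclusion (P_le_A n k))) fun σ hσ => by
    have h : johnsonElem (Subgroup.inclusion (P_le_A n k) σ) = 0 :=
      johnsonElem_eq_zero _ (Subgroup.mem_subgroupOf.mp hσ).2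
    exact congrArg Multiplicative.ofAdd h

/-- The image of `τ_k^P`, as a `ℤ`-submodule of `Hom(H, 𝓛_n(k+1))`. -/
def imTauP (n k : ℕ) (hk : 1 ≤ k) : Submodule ℤ (DerL n k) :=
  AddSubgroup.toIntSubmodule (Subgroup.toAddSubgroup' (tauP n k hk).range)

theorem mem_imTauP {n k : ℕ} (hk : 1 ≤ k) (X : DerL n k) :
    X ∈ imTauP n k hk ↔ ∃ s : grP n k, tauP n k hk s = Multiplicative.ofAdd X := Iff.rfl

end McCoolJohnson

end

noncomputable section

namespace McCoolJohnson

/-! ## The graded Lie bracket on the lower central series -/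

section Bracket

variable {n : ℕ}

/-! Since `α j = 1`, every word occurring in `𝔭_n(k, α)` contains `x_j` exactly once, and
antisymmetry and Jacobi turn its bracket into an integral combination of brackets `[x_j, u]`, with
`u` a word in the other letters (`bracket_mem_range_br`). An element of `𝔭_n(k, α)` is therefore `∑
x_m^* ⊗ [c_m, x_m]` with every `c_m` such a combination.

On the side of automorphisms, `x_m ↦ g_m x_m g_m⁻¹` with `g_m` of class `c_m` has Johnson image `∑
x_m^* ⊗ [c_m, x_m]`. Start from `x_i ↦ x_j x_i x_j⁻¹` with `i ≠ j` and take successive commutators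
with the automorphisms `x_j ↦ x_a x_j x_a⁻¹`. Each one prepends `a` to `u` in position `i`, up to
sign, and has any further effect only in position `j` (`Realizes.commutator`, `exists_traceFree`).
So `x_i^* ⊗ [[x_j, u], x_i]` is congruent, modulo the image of `τ_k^P`, to a derivation `x_j^* ⊗ [c,
x_j]`.

The trace is a combination of cyclic words in which `x_j` occurs once; reading each from `x_j`
onwards gives a combination of words `u`. A commutator as above acts on it by `u ↦ ua - au`
(`sum_wTr_commutator`), and the starting automorphism has trace zero, so all these automorphisms are
trace-free and the reduction to position `j` preserves the trace (`exists_sub_mem_imTauP`).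

Finally, for `c = ∑ v_u [x_j, u]` the trace of `x_j^* ⊗ [c, x_j]` is `∑ v_u · (x_j u)`. The cyclic
words `x_j u` are pairwise distinct and, for `k ≥ 2`, none is a power `x_i^k`; vanishing of the
reduced trace forces `v = 0`. For `k = 1` the remaining derivation is zero because `[x_j, x_j] = 0`.
-/

theorem commutator_Gam_le (p : ℕ) : ∀ q, ⁅Gam n p, Gam n q⁆ ≤ Gam n (p + q)
  | 0 => by
    rw [Nat.add_zero]
    exact Subgroup.commutator_le_left _ _
  | 1 => by
    rw [Subgroup.commutator_le]
    exact fun a ha b _ => comm_mem_Gam ha b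
  | q + 2 => by
    -- Three subgroups lemma modulo `Γ(p+q+2)`, with `Γ(q+2) = [Γ(q+1), F]`: the other two triple
    -- commutators vanish by the induction hypothesis for `q + 1`, used at `p + 1` and at `p`.
    let f := QuotientGroup.mk' (Gam n (p + (q + 2)))
    have hs : Function.Surjective f := QuotientGroup.mk'_surjective _
    have hker : ∀ K : Subgroup (FreeGroup (Fin n)),
        K.map f = ⊥ ↔ K ≤ Gam n (p + (q + 2)) := fun K => by
      rw [Subgroup.map_eq_bot_iff, QuotientGroup.ker_mk']
    let u : Subgroup (FreeGroup (Fin n) ⧸ Gam n (p + (q + 2))) := ⊤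
    have ht : (⊤ : Subgroup (FreeGroup (Fin n))).map f = u :=
      Subgroup.map_top_of_surjective f hs
    have h1 : ⁅⁅u, (Gam n p).map f⁆, (Gam n (q + 1)).map f⁆ = ⊥ := by
      rw [← ht, ← Subgroup.map_commutator, ← Subgroup.map_commutator, hker]
      have h0 : ⁅(⊤ : Subgroup (FreeGroup (Fin n))), Gam n p⁆ ≤ Gam n (p + 1) := by
        rw [Subgroup.commutator_comm, Subgroup.commutator_le]
        exact fun a ha b _ => comm_mem_Gam ha b
      refine (Subgroup.commutator_mono h0 le_rfl).trans ?_
      exact (commutator_Gam_le (p + 1) (q + 1)).trans (Gam_antitone n (by omega))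
    have h2 : ⁅⁅(Gam n p).map f, (Gam n (q + 1)).map f⁆, u⁆ = ⊥ := by
      rw [← ht, ← Subgroup.map_commutator, ← Subgroup.map_commutator, hker]
      refine (Subgroup.commutator_mono (commutator_Gam_le p (q + 1)) le_rfl).trans ?_
      rw [Subgroup.commutator_le]
      exact fun a ha b _ => comm_mem_Gam ha b
    have h3 := Subgroup.commutator_commutator_eq_bot_of_rotate h1 h2
    rw [← ht, ← Subgroup.map_commutator, ← Subgroup.map_commutator, hker,
      ← Gam_succ n (q + 1) (by omega), Subgroup.commutator_comm] at h3
    exact h3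

theorem commutator_mem_Gam {p q r : ℕ} (h : p + q = r) {a b : FreeGroup (Fin n)}
    (ha : a ∈ Gam n p) (hb : b ∈ Gam n q) : ⁅a, b⁆ ∈ Gam n r :=
  h ▸ commutator_Gam_le p q (Subgroup.commutator_mem_commutator ha hb)

theorem conj_mem_Gam {k : ℕ} {g : FreeGroup (Fin n)} (hg : g ∈ Gam n k)
    (a : FreeGroup (Fin n)) : a * g * a⁻¹ ∈ Gam n k :=
  (inferInstance : (Gam n k).Normal).conj_mem g hg a

theorem map_mem_Gam {k : ℕ} (σ : MulAut (FreeGroup (Fin n))) {g : FreeGroup (Fin n)}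
    (hg : g ∈ Gam n k) : σ g ∈ Gam n k := by
  rw [← Subgroup.characteristic_iff_map_eq.mp (Gam_characteristic n k) σ]
  exact Subgroup.mem_map_of_mem _ hg

theorem cls_congr {k : ℕ} {g h : FreeGroup (Fin n)} (hg : g ∈ Gam n k) (e : g = h) :
    cls n k g hg = cls n k h (e ▸ hg) := by
  subst e; rfl

theorem cls_eq_zero_iff {k : ℕ} {g : FreeGroup (Fin n)} (hg : g ∈ Gam n k) :
    cls n k g hg = 0 ↔ g ∈ Gam n (k + 1) := by
  rw [show (0 : L n k) = cls n k 1 (Subgroup.one_mem _) from rfl, cls_eq_iff]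
  simp

theorem cls_inv {k : ℕ} {g : FreeGroup (Fin n)} (hg : g ∈ Gam n k) :
    cls n k g⁻¹ (Subgroup.inv_mem _ hg) = -cls n k g hg := rfl

theorem cls_conj {k : ℕ} {g : FreeGroup (Fin n)} (hg : g ∈ Gam n k) (a : FreeGroup (Fin n)) :
    cls n k (a * g * a⁻¹) (conj_mem_Gam hg a) = cls n k g hg := by
  rw [eq_comm, cls_eq_iff]
  have := comm_mem_Gam (Subgroup.inv_mem _ hg) a
  convert this using 1
  simp [commutatorElement_def, mul_assoc]

theorem exists_cls {k : ℕ} (c : L n k) : ∃ (g : FreeGroup (Fin n)) (hg : g ∈ Gam n k),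
    cls n k g hg = c := by
  obtain ⟨g, hg⟩ := QuotientGroup.mk_surjective (Additive.toMul c)
  exact ⟨g.1, g.2, congrArg Additive.ofMul hg⟩

/-- A representative in `Γ_n(k)` of an element of `𝓛_n(k)`. -/
def rep {k : ℕ} (c : L n k) : FreeGroup (Fin n) := (exists_cls c).choose

theorem rep_mem {k : ℕ} (c : L n k) : rep c ∈ Gam n k := (exists_cls c).choose_spec.choose

theorem cls_rep {k : ℕ} (c : L n k) : cls n k (rep c) (rep_mem c) = c :=
  (exists_cls c).choose_spec.choose_spec

/-- `⁅a a', b⁆ = (a ⁅a', b⁆ a⁻¹) ⁅a, b⁆`, and conjugation acts trivially on the graded pieces. -/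
theorem cls_commutator_mul_left {p q r : ℕ} (h : p + q = r) {a a' b : FreeGroup (Fin n)}
    (ha : a ∈ Gam n p) (ha' : a' ∈ Gam n p) (hb : b ∈ Gam n q) :
    cls n r ⁅a * a', b⁆ (commutator_mem_Gam h (Subgroup.mul_mem _ ha ha') hb) =
      cls n r ⁅a, b⁆ (commutator_mem_Gam h ha hb) +
        cls n r ⁅a', b⁆ (commutator_mem_Gam h ha' hb) := by
  rw [add_comm, ← cls_conj (commutator_mem_Gam h ha' hb) a, ← cls_mul]
  exact cls_congr _ (by simp [commutatorElement_def, mul_assoc])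

theorem cls_commutator_swap {p q r : ℕ} (h : p + q = r) (h' : q + p = r)
    {a b : FreeGroup (Fin n)} (ha : a ∈ Gam n p) (hb : b ∈ Gam n q) :
    cls n r ⁅a, b⁆ (commutator_mem_Gam h ha hb) =
      -cls n r ⁅b, a⁆ (commutator_mem_Gam h' hb ha) := by
  rw [← cls_inv]
  exact cls_congr _ (by simp)

/-- Changing `a` by an element of `Γ(p+1)` changes the commutator by one of `Γ(r+1)`; antisymmetry
handles `b`. This makes `lie` independent of the chosen representatives. -/
theorem cls_commutator_congr {p q r : ℕ} (h : p + q = r) {a a' b b' : FreeGroup (Fin n)}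
    (ha : a ∈ Gam n p) (ha' : a' ∈ Gam n p) (hb : b ∈ Gam n q) (hb' : b' ∈ Gam n q)
    (e : cls n p a ha = cls n p a' ha') (e' : cls n q b hb = cls n q b' hb') :
    cls n r ⁅a, b⁆ (commutator_mem_Gam h ha hb) =
      cls n r ⁅a', b'⁆ (commutator_mem_Gam h ha' hb') := by
  have left : ∀ {p q : ℕ} (h : p + q = r) {a a' b : FreeGroup (Fin n)}
      (ha : a ∈ Gam n p) (ha' : a' ∈ Gam n p) (hb : b ∈ Gam n q)
      (_ : cls n p a ha = cls n p a' ha'),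
      cls n r ⁅a, b⁆ (commutator_mem_Gam h ha hb) =
        cls n r ⁅a', b⁆ (commutator_mem_Gam h ha' hb) := by
    intro p q h a a' b ha ha' hb e
    have hc := (cls_eq_iff ha ha').mp e
    have hm := Subgroup.mul_mem _ (Subgroup.inv_mem _ ha) ha'
    have h1 := cls_commutator_mul_left h ha hm hb
    have h2 : cls n r ⁅a⁻¹ * a', b⁆ (commutator_mem_Gam h hm hb) = 0 :=
      (cls_eq_zero_iff _).mpr (commutator_mem_Gam (by omega) hc hb)
    rw [h2, add_zero] at h1
    rw [← h1]
    exact cls_congr _ (by simp)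
  have h' : q + p = r := by omega
  rw [left h ha ha' hb e, cls_commutator_swap h h' ha' hb, left h' hb hb' ha' e',
    ← cls_commutator_swap h h' ha' hb']

/-- The bracket `𝓛_n(p) × 𝓛_n(q) → 𝓛_n(r)` for `p + q = r`. -/
def lie {p q r : ℕ} (h : p + q = r) (c : L n p) (d : L n q) : L n r :=
  cls n r ⁅rep c, rep d⁆ (commutator_mem_Gam h (rep_mem c) (rep_mem d))

theorem lie_cls {p q r : ℕ} (h : p + q = r) {a b : FreeGroup (Fin n)} (ha : a ∈ Gam n p)
    (hb : b ∈ Gam n q) :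
    lie h (cls n p a ha) (cls n q b hb) = cls n r ⁅a, b⁆ (commutator_mem_Gam h ha hb) :=
  cls_commutator_congr h _ _ _ _ (cls_rep _) (cls_rep _)

theorem lie_swap {p q r : ℕ} (h : p + q = r) (h' : q + p = r) (c : L n p) (d : L n q) :
    lie h c d = -lie h' d c :=
  cls_commutator_swap h h' (rep_mem c) (rep_mem d)

theorem lie_add_left {p q r : ℕ} (h : p + q = r) (c c' : L n p) (d : L n q) :
    lie h (c + c') d = lie h c d + lie h c' d := by
  obtain ⟨a, ha, rfl⟩ := exists_cls c
  obtain ⟨a', ha', rfl⟩ := exists_cls c'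
  obtain ⟨b, hb, rfl⟩ := exists_cls d
  rw [← cls_mul, lie_cls, lie_cls, lie_cls,
    cls_commutator_mul_left h ha ha' hb]

theorem lie_add_right {p q r : ℕ} (h : p + q = r) (c : L n p) (d d' : L n q) :
    lie h c (d + d') = lie h c d + lie h c d' := by
  have h' : q + p = r := by omega
  rw [lie_swap h h', lie_swap h h', lie_swap h h', lie_add_left, neg_add]

/-- The bracket on the graded pieces of the lower central series, as a bilinear map. -/
def lieHom {p q r : ℕ} (h : p + q = r) : L n p →ₗ[ℤ] L n q →ₗ[ℤ] L n r :=
  (AddMonoidHom.mk' (fun c => (AddMonoidHom.mk' (lie h c) (lie_add_right h c)).toIntLinearMap)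
    fun c c' => LinearMap.ext fun d => lie_add_left h c c' d).toIntLinearMap

theorem lieHom_cls {p q r : ℕ} (h : p + q = r) {a b : FreeGroup (Fin n)} (ha : a ∈ Gam n p)
    (hb : b ∈ Gam n q) :
    lieHom h (cls n p a ha) (cls n q b hb) = cls n r ⁅a, b⁆ (commutator_mem_Gam h ha hb) :=
  lie_cls h ha hb

theorem lieHom_swap {p q r : ℕ} (h : p + q = r) (h' : q + p = r) (c : L n p) (d : L n q) :
    lieHom h c d = -lieHom h' d c :=
  lie_swap h h' c d

/-- The Hall–Witt identity: the product of `⁅⁅a, b⁆, b c b⁻¹⁆` and its two cyclic analogues is `1`,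
and the conjugations are invisible in the graded pieces. -/
theorem lieHom_jacobi {p q r pq qr rp s : ℕ} (hpq : p + q = pq) (hqr : q + r = qr)
    (hrp : r + p = rp) (h1 : pq + r = s) (h2 : qr + p = s) (h3 : rp + q = s)
    (x : L n p) (y : L n q) (z : L n r) :
    lieHom h1 (lieHom hpq x y) z + lieHom h2 (lieHom hqr y z) x +
      lieHom h3 (lieHom hrp z x) y = 0 := by
  obtain ⟨a, ha, rfl⟩ := exists_cls x
  obtain ⟨b, hb, rfl⟩ := exists_cls y
  obtain ⟨c, hc, rfl⟩ := exists_cls z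
  have key : ∀ {p q r pq : ℕ} (hpq : p + q = pq) (h1 : pq + r = s) {a b c : FreeGroup (Fin n)}
      (ha : a ∈ Gam n p) (hb : b ∈ Gam n q) (hc : c ∈ Gam n r),
      lieHom h1 (lieHom hpq (cls n p a ha) (cls n q b hb)) (cls n r c hc) =
        cls n s ⁅⁅a, b⁆, b * c * b⁻¹⁆
          (commutator_mem_Gam h1 (commutator_mem_Gam hpq ha hb) (conj_mem_Gam hc b)) := by
    intro p q r pq hpq h1 a b c ha hb hc
    rw [← cls_conj hc b, lieHom_cls, lieHom_cls]
  rw [key hpq h1 ha hb hc, key hqr h2 hb hc ha, key hrp h3 hc ha hb, ← cls_mul, ← cls_mul]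
  rw [cls_congr _ (commutatorElement_commutatorElement_conj_mul a b c)]
  rfl

end Bracket

/-! ## Brackets of words with a single occurrence of a fixed letter -/

section Words

variable {n : ℕ}

/-- Right bracketing with the generator `x_b`. -/
def adR (b : Fin n) (k : ℕ) : L n (k + 1) →ₗ[ℤ] L n (k + 1 + 1) :=
  (lieHom rfl).flip (cls n 1 (FreeGroup.of b) (mem_Gam_one _))

theorem adR_cls (b : Fin n) {k : ℕ} {g : FreeGroup (Fin n)} (hg : g ∈ Gam n (k + 1)) :
    adR b k (cls n (k + 1) g hg) = cls n (k + 1 + 1) ⁅g, FreeGroup.of b⁆ (comm_mem_Gam hg _) :=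
  lieHom_cls rfl hg (mem_Gam_one _)

theorem bracket_snoc {m : ℕ} (w : Fin (m + 1) → Fin n) (b : Fin n) :
    bracket n (m + 1) (Fin.snoc (α := fun _ => Fin n) w b) = adR b m (bracket n m w) := by
  rw [bracket, bracket, adR_cls]
  refine cls_congr _ ?_
  rw [leftNormed, Fin.init_snoc, Fin.snoc_last]

variable (j : Fin n)

/-- The letters other than `x_j`. -/
abbrev Letter : Type := {b : Fin n // b ≠ j}

/-- The free abelian group on the words of length `k` in the letters other than `x_j`. -/
abbrev U (k : ℕ) : Type := (Fin k → Letter j) →₀ ℤ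

/-- The word `x_j u`. -/
def jWord {k : ℕ} (u : Fin k → Letter j) : Fin (k + 1) → Fin n :=
  Fin.cons j fun l => (u l : Fin n)

/-- The linear map sending a word `u` to the left-normed bracket `[x_j, u]`. -/
def br (k : ℕ) : U j k →ₗ[ℤ] L n (k + 1) :=
  Finsupp.linearCombination ℤ fun u => bracket n k (jWord j u)

variable {j}

theorem br_single {k : ℕ} (u : Fin k → Letter j) :
    br j k (Finsupp.single u 1) = bracket n k (jWord j u) := by
  simp [br]

/-- Appending a letter to a word. -/
def snocU (a : Letter j) (k : ℕ) : U j k →ₗ[ℤ] U j (k + 1) :=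
  Finsupp.lmapDomain ℤ ℤ fun u => Fin.snoc (α := fun _ => Letter j) u a

/-- Prepending a letter to a word. -/
def consU (a : Letter j) (k : ℕ) : U j k →ₗ[ℤ] U j (k + 1) :=
  Finsupp.lmapDomain ℤ ℤ fun u => Fin.cons (α := fun _ => Letter j) a u

theorem snocU_single (a : Letter j) {k : ℕ} (u : Fin k → Letter j) :
    snocU a k (Finsupp.single u 1) =
      Finsupp.single (Fin.snoc (α := fun _ => Letter j) u a) 1 := by
  simp [snocU]

theorem consU_single (a : Letter j) {k : ℕ} (u : Fin k → Letter j) :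
    consU a k (Finsupp.single u 1) =
      Finsupp.single (Fin.cons (α := fun _ => Letter j) a u) 1 := by
  simp [consU]

theorem jWord_snoc {k : ℕ} (u : Fin k → Letter j) (a : Letter j) :
    jWord j (Fin.snoc (α := fun _ => Letter j) u a) =
      Fin.snoc (α := fun _ => Fin n) (jWord j u) a := by
  unfold jWord
  rw [← Fin.cons_snoc_eq_snoc_cons]
  congr 1
  exact Fin.comp_snoc (fun b : Letter j => (b : Fin n)) u a

theorem br_snocU (a : Letter j) {k : ℕ} (v : U j k) :
    br j (k + 1) (snocU a k v) = adR (a : Fin n) k (br j k v) := by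
  have : br j (k + 1) ∘ₗ snocU a k = adR (a : Fin n) k ∘ₗ br j k := by
    ext u
    simp only [LinearMap.comp_apply, Finsupp.lsingle_apply, snocU_single, br_single, jWord_snoc,
      bracket_snoc]
  exact LinearMap.congr_fun this v

/-- For a word `w' b`, Jacobi gives `[c, [w', b]] = [[c, w'], b] - [[c, b], w']`. The second term
changes `c` and its degree, so the induction runs over all of these. -/
theorem lieHom_bracket_mem_range_br : ∀ (m k t : ℕ) (h : (k + 1) + (m + 1) = t + 1)
    (w : Fin (m + 1) → Fin n) (_ : ∀ l, w l ≠ j) (c : L n (k + 1)) (_ : c ∈ LinearMap.range (br j k)),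
    lieHom h c (bracket n m w) ∈ LinearMap.range (br j t)
  | 0, k, t, h, w, hw, c, hc => by
    obtain rfl : t = k + 1 := by omega
    obtain ⟨v, rfl⟩ := hc
    exact ⟨snocU ⟨w 0, hw 0⟩ k v, br_snocU _ _⟩
  | m + 1, k, t, h, w, hw, c, hc => by
    obtain ⟨t, rfl⟩ : ∃ s, t = s + 1 := ⟨t - 1, by omega⟩
    have hadR : ∀ (s : ℕ) (b : Fin n) (_ : b ≠ j) (d : L n (s + 1)),
        d ∈ LinearMap.range (br j s) → adR b s d ∈ LinearMap.range (br j (s + 1)) := by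
      rintro s b hb _ ⟨v, rfl⟩
      exact ⟨snocU ⟨b, hb⟩ s v, br_snocU _ _⟩
    have hb := hw (Fin.last (m + 1))
    rw [← Fin.snoc_init_self (α := fun _ => Fin n) w, bracket_snoc]
    have h1 := lieHom_bracket_mem_range_br m k t (by omega) (Fin.init w) (fun l => hw _) c hc
    have h2 := lieHom_bracket_mem_range_br m (k + 1) (t + 1) (by omega) (Fin.init w)
      (fun l => hw _) _ (hadR k _ hb c hc)
    have h3 := hadR _ _ hb _ h1
    have J := lieHom_jacobi (n := n) (p := k + 1) (q := m + 1) (r := 1) (s := t + 1 + 1)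
      (pq := t + 1) (qr := m + 1 + 1) (rp := k + 1 + 1) (by omega) rfl (by omega) (by omega)
      (by omega) (by omega) c (bracket n m (Fin.init w))
      (cls n 1 (FreeGroup.of (w (Fin.last (m + 1)))) (mem_Gam_one _))
    rw [lieHom_swap _ h, lieHom_swap (p := 1) (q := k + 1) _ rfl, map_neg, LinearMap.neg_apply] at J
    have e := add_neg_eq_zero.mp ((add_right_comm _ _ _).trans J)
    rw [← sub_eq_add_neg] at e
    change lieHom h c _ ∈ _
    refine Eq.subst (motive := fun y => y ∈ LinearMap.range (br j (t + 1))) e ?_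
    exact Submodule.sub_mem _ h3 h2

/-- The bracket of a word with exactly one occurrence of `x_j` is a combination of brackets of
words beginning with `x_j`. -/
theorem bracket_mem_range_br : ∀ (k : ℕ) (w : Fin (k + 1) → Fin n)
    (_ : (Finset.univ.filter fun l => w l = j).card = 1),
    bracket n k w ∈ LinearMap.range (br j k)
  | 0, w, hw => by
    refine ⟨Finsupp.single Fin.elim0 1, ?_⟩
    rw [br_single]
    congr 1
    ext l
    obtain ⟨a, ha⟩ := Finset.card_eq_one.mp hw
    have : a ∈ Finset.univ.filter fun l => w l = j := by rw [ha]; simp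
    obtain rfl : l = a := Subsingleton.elim (α := Fin 1) l a
    obtain rfl : l = 0 := Subsingleton.elim (α := Fin 1) l 0
    simp [jWord, (Finset.mem_filter.mp this).2]
  | k + 1, w, hw => by
    have hc : (Finset.univ.filter fun l => w l = j).card =
        (Finset.univ.filter fun l => Fin.init w l = j).card +
          if w (Fin.last (k + 1)) = j then 1 else 0 := by
      simp only [Finset.card_filter]
      rw [Fin.sum_univ_castSucc]
      rfl
    rw [hw] at hc
    rw [← Fin.snoc_init_self (α := fun _ => Fin n) w, bracket_snoc]
    -- A final `x_j` is moved to the front by antisymmetry, and the remaining bracket, free of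
    -- `x_j`, is absorbed by the previous lemma. Any other final letter is simply appended.
    by_cases hb : w (Fin.last (k + 1)) = j
    · rw [if_pos hb] at hc
      have h0 : (Finset.univ.filter fun l => Fin.init w l = j).card = 0 := by omega
      rw [Finset.card_eq_zero, Finset.filter_eq_empty_iff] at h0
      have hj : cls n 1 (FreeGroup.of j) (mem_Gam_one _) ∈ LinearMap.range (br j 0) :=
        ⟨Finsupp.single Fin.elim0 1, br_single _⟩
      rw [hb, adR, LinearMap.flip_apply, lieHom_swap _ (by omega)]
      exact Submodule.neg_mem _ (lieHom_bracket_mem_range_br k 0 (k + 1) (by omega) (Fin.init w)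
        (fun l => h0 (Finset.mem_univ l)) _ hj)
    · rw [if_neg hb] at hc
      obtain ⟨v, hv⟩ := bracket_mem_range_br k (Fin.init w) (by omega)
      rw [← hv]
      exact ⟨snocU ⟨_, hb⟩ k v, br_snocU _ _⟩

end Words

/-! ## Basis-conjugating automorphisms and their commutators -/

section Automorphisms

variable {n : ℕ}

theorem mem_A_of_generators {k : ℕ} {σ : MulAut (FreeGroup (Fin n))}
    (h : ∀ i, (FreeGroup.of i)⁻¹ * σ (FreeGroup.of i) ∈ Gam n (k + 1)) : σ ∈ A n k := by
  let f := QuotientGroup.mk' (Gam n (k + 1))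
  have e : f = f.comp σ.toMonoidHom := FreeGroup.ext_hom _ _ fun i => QuotientGroup.eq.mpr (h i)
  exact fun g => QuotientGroup.eq.mp (DFunLike.congr_fun e g)

theorem inv_mul_conj_eq (g y : FreeGroup (Fin n)) :
    y⁻¹ * (g * y * g⁻¹) = y⁻¹ * ⁅g, y⁆ * y⁻¹⁻¹ := by
  simp [commutatorElement_def, mul_assoc]

/-- The automorphism `x_i ↦ x_a x_i x_a⁻¹` fixing the other generators. -/
def conjAut (i a : Fin n) (h : a ≠ i) : MulAut (FreeGroup (Fin n)) :=
  MonoidHom.toMulEquiv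
    (FreeGroup.lift fun m => if m = i then FreeGroup.of a * FreeGroup.of i * (FreeGroup.of a)⁻¹
      else FreeGroup.of m)
    (FreeGroup.lift fun m => if m = i then (FreeGroup.of a)⁻¹ * FreeGroup.of i * FreeGroup.of a
      else FreeGroup.of m)
    (FreeGroup.ext_hom _ _ fun m => by
      by_cases hm : m = i
      · simp [hm, h, mul_assoc]
      · simp [hm])
    (FreeGroup.ext_hom _ _ fun m => by
      by_cases hm : m = i
      · simp [hm, h, mul_assoc]
      · simp [hm])

theorem conjAut_of (i a : Fin n) (h : a ≠ i) (m : Fin n) :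
    conjAut i a h (FreeGroup.of m) = (if m = i then FreeGroup.of a else 1) * FreeGroup.of m *
      (if m = i then FreeGroup.of a else 1)⁻¹ := by
  change FreeGroup.lift (fun m => if m = i then
    FreeGroup.of a * FreeGroup.of i * (FreeGroup.of a)⁻¹ else FreeGroup.of m)
      (FreeGroup.of m) = _
  rw [FreeGroup.lift_apply_of]
  by_cases hm : m = i <;> simp [hm]

theorem conjAut_of_ne {i a : Fin n} (h : a ≠ i) {m : Fin n} (hm : m ≠ i) :
    conjAut i a h (FreeGroup.of m) = FreeGroup.of m := by
  simp [conjAut_of, hm]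

theorem conjAut_mem_A (i a : Fin n) (h : a ≠ i) : conjAut i a h ∈ A n 1 := by
  refine mem_A_of_generators fun m => ?_
  rw [conjAut_of, inv_mul_conj_eq]
  exact conj_mem_Gam (comm_mem_Gam (mem_Gam_one _) _) _

/-- The map `𝓛_n(k) → 𝓛_n(k+1)` induced by `g ↦ g⁻¹ κ(g)`, for `κ ∈ 𝓐_n(1)`. -/
def deltaFun (κ : A n 1) (k : ℕ) (c : L n (k + 1)) : L n (k + 1 + 1) :=
  cls n (k + 1 + 1) ((rep c)⁻¹ * (κ : MulAut (FreeGroup (Fin n))) (rep c))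
    (act_trivial κ.2 k _ (rep_mem c))

/-- Replacing `g` by `g h` with `h ∈ Γ(k+2)` inserts factors `h⁻¹` and `κ(h)`; these cancel because
`κ(h) ≡ h` modulo `Γ(k+3)`. -/
theorem deltaFun_cls (κ : A n 1) {k : ℕ} {g : FreeGroup (Fin n)} (hg : g ∈ Gam n (k + 1)) :
    deltaFun κ k (cls n (k + 1) g hg) =
      cls n (k + 1 + 1) (g⁻¹ * (κ : MulAut (FreeGroup (Fin n))) g) (act_trivial κ.2 k _ hg) := by
  have e := (cls_eq_iff hg (rep_mem _)).mp (cls_rep (cls n (k + 1) g hg)).symm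
  have hκ := act_trivial κ.2 (k + 1) _ e
  rw [deltaFun]
  set g' := rep (cls n (k + 1) g hg)
  set s := (κ : MulAut (FreeGroup (Fin n)))
  have hs : s (g⁻¹ * g') ∈ Gam n (k + 1 + 1) := map_mem_Gam s e
  have hs' : cls n _ _ hs = cls n _ _ e := ((cls_eq_iff e hs).mpr hκ).symm
  have hd := act_trivial κ.2 k _ hg
  have h1 : g'⁻¹ * s g' = (g⁻¹ * g')⁻¹ * (g⁻¹ * s g) * s (g⁻¹ * g') := by simp [mul_assoc]
  rw [cls_congr _ h1, cls_mul (Subgroup.mul_mem _ (Subgroup.inv_mem _ e) hd) hs,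
    cls_mul (Subgroup.inv_mem _ e) hd, cls_inv e, hs']
  abel

/-- `deltaFun` as a linear map. -/
def delta (κ : A n 1) (k : ℕ) : L n (k + 1) →ₗ[ℤ] L n (k + 1 + 1) :=
  (AddMonoidHom.mk' (deltaFun κ k) fun c d => by
    obtain ⟨g, hg, rfl⟩ := exists_cls c
    obtain ⟨h, hh, rfl⟩ := exists_cls d
    rw [← cls_mul, deltaFun_cls, deltaFun_cls, deltaFun_cls,
      ← cls_conj (act_trivial κ.2 k _ hg) h⁻¹, ← cls_mul]
    exact cls_congr _ (by simp [mul_assoc])).toIntLinearMap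

theorem delta_cls (κ : A n 1) {k : ℕ} {g : FreeGroup (Fin n)} (hg : g ∈ Gam n (k + 1)) :
    delta κ k (cls n (k + 1) g hg) =
      cls n (k + 1 + 1) (g⁻¹ * (κ : MulAut (FreeGroup (Fin n))) g) (act_trivial κ.2 k _ hg) :=
  deltaFun_cls κ hg

/-- The Leibniz rule for `delta κ`, in the case where it kills the generator `x_b`. -/
theorem delta_adR (κ : A n 1) {b : Fin n}
    (hb : (κ : MulAut (FreeGroup (Fin n))) (FreeGroup.of b) = FreeGroup.of b) {k : ℕ}
    (c : L n (k + 1)) : delta κ (k + 1) (adR b k c) = adR b (k + 1) (delta κ k c) := by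
  obtain ⟨g, hg, rfl⟩ := exists_cls c
  have hd := act_trivial κ.2 k _ hg
  rw [adR_cls, delta_cls, delta_cls, adR_cls,
    ← cls_conj (comm_mem_Gam hd _) (⁅g, FreeGroup.of b⁆⁻¹ * g)]
  refine cls_congr _ ?_
  rw [map_commutatorElement, hb]
  simp [commutatorElement_def, mul_assoc]

/-- Here `delta` is the derivation with `x_j ↦ [x_a, x_j] = -[x_j, x_a]` that kills the other
generators, so it inserts `a` directly after `x_j`, with a sign. -/
theorem delta_bracket_jWord {j : Fin n} (a : Letter j) : ∀ (k : ℕ) (u : Fin k → Letter j),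
    delta ⟨conjAut j a a.2, conjAut_mem_A _ _ _⟩ k (bracket n k (jWord j u)) =
      -bracket n (k + 1) (jWord j (Fin.cons (α := fun _ => Letter j) a u))
  | 0, u => by
    rw [bracket, bracket, delta_cls, ← cls_inv,
      ← cls_conj (Subgroup.inv_mem _ (leftNormed_mem _ _ _)) (FreeGroup.of j)⁻¹]
    refine cls_congr _ ?_
    simp [leftNormed, jWord, conjAut_of, commutatorElement_def, mul_assoc, Fin.init]
  | k + 1, u => by
    rw [← Fin.snoc_init_self (α := fun _ => Letter j) u, Fin.cons_snoc_eq_snoc_cons, jWord_snoc,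
      jWord_snoc, bracket_snoc, bracket_snoc, delta_adR _ (by exact conjAut_of_ne a.2 (u _).2),
      delta_bracket_jWord a k, map_neg]

theorem delta_br {j : Fin n} (a : Letter j) {k : ℕ} (v : U j k) :
    delta ⟨conjAut j a a.2, conjAut_mem_A _ _ _⟩ k (br j k v) = -br j (k + 1) (consU a k v) := by
  have : delta ⟨conjAut j a a.2, conjAut_mem_A _ _ _⟩ k ∘ₗ br j k =
      -(br j (k + 1) ∘ₗ consU a k) := by
    ext u
    simp only [LinearMap.comp_apply, Finsupp.lsingle_apply, consU_single, br_single,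
      delta_bracket_jWord, LinearMap.neg_apply]
  exact LinearMap.congr_fun this v

/-- The tuple `c` is realized by a basis-conjugating automorphism `x_m ↦ g_m x_m g_m⁻¹` with
`g_m` of class `c_m`. -/
def Realizes (k : ℕ) (c : Fin n → L n (k + 1)) : Prop :=
  ∃ (σ : MulAut (FreeGroup (Fin n))) (g : Fin n → FreeGroup (Fin n))
    (hg : ∀ m, g m ∈ Gam n (k + 1)),
    (∀ m, σ (FreeGroup.of m) = g m * FreeGroup.of m * (g m)⁻¹) ∧
      ∀ m, cls n (k + 1) (g m) (hg m) = c m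

theorem mem_A_of_conj {k : ℕ} {σ : MulAut (FreeGroup (Fin n))} {g : Fin n → FreeGroup (Fin n)}
    (hg : ∀ m, g m ∈ Gam n (k + 1))
    (hσ : ∀ m, σ (FreeGroup.of m) = g m * FreeGroup.of m * (g m)⁻¹) : σ ∈ A n (k + 1) :=
  mem_A_of_generators fun m => by
    rw [hσ, inv_mul_conj_eq]
    exact conj_mem_Gam (comm_mem_Gam (hg m) _) _

theorem realizes_conjAut (i a : Fin n) (h : a ≠ i) :
    Realizes 0 (fun m => if m = i then cls n 1 (FreeGroup.of a) (mem_Gam_one _) else 0) := by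
  refine ⟨conjAut i a h, fun m => if m = i then FreeGroup.of a else 1, fun m => mem_Gam_one _,
    conjAut_of i a h, fun m => ?_⟩
  by_cases hm : m = i
  · simp [hm]
  · simp only [hm, if_false]
    rfl

/-- Put `ρ = κ σ κ⁻¹ σ⁻¹` and evaluate `ρ σ κ = κ σ` at `x_m`. Here `σ κ` conjugates `x_m` by `y_m =
σ(e_m) g_m` and `κ σ` conjugates it by `z_m = κ(g_m) e_m`, so `ρ` conjugates it by `ρ(y_m)⁻¹ z_m`,
which has the class of `y_m⁻¹ z_m`. -/
theorem Realizes.commutator {k : ℕ} {c : Fin n → L n (k + 1)} (hc : Realizes k c)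
    (j a : Fin n) (h : a ≠ j) :
    Realizes (k + 1) fun m => delta ⟨conjAut j a h, conjAut_mem_A _ _ _⟩ k (c m) +
      if m = j then adR a k (c j) - adR a k (c a) else 0 := by
  obtain ⟨σ, g, hg, hσ, hgc⟩ := hc
  have hσA := mem_A_of_conj hg hσ
  set κ := conjAut j a h with hκ
  have hκA : κ ∈ A n 1 := conjAut_mem_A j a h
  let e : Fin n → FreeGroup (Fin n) := fun m => if m = j then FreeGroup.of a else 1
  have he : ∀ m, κ (FreeGroup.of m) = e m * FreeGroup.of m * (e m)⁻¹ := conjAut_of j a h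
  let ρ : MulAut (FreeGroup (Fin n)) := κ * σ * κ⁻¹ * σ⁻¹
  have hρA : ρ ∈ A n (k + 1) :=
    Subgroup.mul_mem _ ((A_normal n (k + 1)).conj_mem _ hσA _) (Subgroup.inv_mem _ hσA)
  have hρ : ∀ y, ρ (σ (κ y)) = κ (σ y) := fun y => by simp [ρ, MulAut.mul_apply]
  let y : Fin n → FreeGroup (Fin n) := fun m => σ (e m) * g m
  let z : Fin n → FreeGroup (Fin n) := fun m => κ (g m) * e m
  have hyz : ∀ m, ∃ hm : (y m)⁻¹ * z m ∈ Gam n (k + 1 + 1), cls n (k + 1 + 1) _ hm =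
      delta ⟨κ, hκA⟩ k (c m) + if m = j then adR a k (c j) - adR a k (c a) else 0 := by
    intro m
    rw [← hgc m, delta_cls]
    have hd : (g m)⁻¹ * κ (g m) ∈ Gam n (k + 1 + 1) := act_trivial hκA k _ (hg m)
    by_cases hm : m = j
    · subst hm
      have h1 := comm_mem_Gam (hg a) (FreeGroup.of a)
      have h2 := comm_mem_Gam (hg m) (FreeGroup.of a)
      -- From `σ(x_a) = ⁅g_a, x_a⁆ x_a`: a product of conjugates of `⁅g_a, x_a⁆⁻¹`, `⁅g_j, x_a⁆` and
      -- `g_j⁻¹ κ(g_j)`, one for each term of the claimed class.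
      have eq : (y m)⁻¹ * z m = ((g m)⁻¹ * (FreeGroup.of a)⁻¹) * ⁅g a, FreeGroup.of a⁆⁻¹ *
          ((g m)⁻¹ * (FreeGroup.of a)⁻¹)⁻¹ * ((FreeGroup.of a * g m)⁻¹ *
            ⁅g m, FreeGroup.of a⁆ * (FreeGroup.of a * g m)⁻¹⁻¹) *
          ((FreeGroup.of a)⁻¹ * ((g m)⁻¹ * κ (g m)) * (FreeGroup.of a)⁻¹⁻¹) := by
        simp [y, z, e, hσ, commutatorElement_def, mul_assoc]
      have m1 := conj_mem_Gam (Subgroup.inv_mem _ h1) ((g m)⁻¹ * (FreeGroup.of a)⁻¹)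
      have m2 := conj_mem_Gam h2 (FreeGroup.of a * g m)⁻¹
      have m3 := conj_mem_Gam hd (FreeGroup.of a)⁻¹
      have m12 := Subgroup.mul_mem _ m1 m2
      refine ⟨eq ▸ Subgroup.mul_mem _ m12 m3, ?_⟩
      rw [cls_congr _ eq, cls_mul m12 m3, cls_mul m1 m2, cls_conj (Subgroup.inv_mem _ h1),
        cls_conj h2, cls_conj hd, cls_inv h1, if_pos rfl, ← hgc a, ← hgc m, adR_cls, adR_cls]
      abel
    · have eq : (y m)⁻¹ * z m = (g m)⁻¹ * κ (g m) := by simp [y, z, e, hm]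
      refine ⟨eq ▸ hd, ?_⟩
      rw [cls_congr _ eq, if_neg hm, add_zero]
  -- A bootstrap: normality gives only `ρ ∈ 𝓐(k+1)`, which already places the conjugators in
  -- `Γ(k+2)`. Hence `ρ ∈ 𝓐(k+2)`, and then `ρ(y_m)` may be replaced by `y_m` modulo `Γ(k+3)`.
  have hg' : ∀ m, (ρ (y m))⁻¹ * z m ∈ Gam n (k + 1 + 1) := fun m => by
    have := Subgroup.mul_mem _ (Subgroup.inv_mem _ (hρA (y m))) (hyz m).choose
    simpa [mul_assoc] using this
  have hρx : ∀ m, ρ (FreeGroup.of m) =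
      ((ρ (y m))⁻¹ * z m) * FreeGroup.of m * ((ρ (y m))⁻¹ * z m)⁻¹ := by
    intro m
    have h1 : σ (κ (FreeGroup.of m)) = y m * FreeGroup.of m * (y m)⁻¹ := by
      simp [he, hσ, y, mul_assoc]
    have h2 : κ (σ (FreeGroup.of m)) = z m * FreeGroup.of m * (z m)⁻¹ := by
      simp [he, hσ, z, mul_assoc]
    have h3 := hρ (FreeGroup.of m)
    rw [h1, h2, map_mul, map_mul, map_inv] at h3
    have h4 : ρ (FreeGroup.of m) =
        (ρ (y m))⁻¹ * (ρ (y m) * ρ (FreeGroup.of m) * (ρ (y m))⁻¹) * ρ (y m) := by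
      simp [mul_assoc]
    rw [h4, h3]
    simp [mul_assoc]
  have hρA' := mem_A_of_conj hg' hρx
  refine ⟨ρ, fun m => (ρ (y m))⁻¹ * z m, hg', hρx, fun m => ?_⟩
  refine Eq.trans ?_ (hyz m).choose_spec
  rw [cls_eq_iff]
  have h5 := conj_mem_Gam (hρA' (y m)) ((z m)⁻¹ * y m)
  convert h5 using 1
  simp [mul_assoc]

end Automorphisms

/-! ## Derivations `x_m ↦ [c, x_m]` and the image of the Johnson homomorphism -/

section Derivations

variable {n : ℕ}

theorem linearMap_H_ext {M : Type*} [AddCommGroup M] {f f' : H n →ₗ[ℤ] M}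
    (h : ∀ i, f (x i) = f' (x i)) : f = f' := by
  refine LinearMap.ext fun y => ?_
  obtain ⟨g, hg⟩ := QuotientGroup.mk_surjective (Additive.toMul y)
  obtain rfl : y = Additive.ofMul (Abelianization.of g) := (congrArg Additive.ofMul hg).symm
  clear hg
  induction g using FreeGroup.induction_on with
  | C1 => rw [map_one, ofMul_one, map_zero, map_zero]
  | of i => exact h i
  | inv_of i h => rw [map_inv, ofMul_inv, map_neg, map_neg, h]
  | mul a b ha hb => rw [map_mul, ofMul_mul, map_add, map_add, ha, hb]

/-- The derivation `x_m^* ⊗ [c, x_m]`, as a linear function of `c`. -/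
def conjDer (m : Fin n) (k : ℕ) : L n (k + 1) →ₗ[ℤ] DerL n (k + 1) :=
  LinearMap.smulRightₗ (xDual m) ∘ₗ adR m k

theorem conjDer_apply (m : Fin n) {k : ℕ} (c : L n (k + 1)) :
    conjDer m k c = elem m (adR m k c) := rfl

theorem Realizes.sum_conjDer_mem_imTauP {k : ℕ} {c : Fin n → L n (k + 1)} (hc : Realizes k c) (hk : 1 ≤ k + 1) :
    ∑ m, conjDer m k (c m) ∈ imTauP n (k + 1) hk := by
  obtain ⟨σ, g, hg, hσ, hgc⟩ := hc
  have hσA := mem_A_of_conj hg hσ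
  have hσP : σ ∈ P n (k + 1) := ⟨fun m => isConj_iff.mpr ⟨g m, (hσ m).symm⟩, hσA⟩
  rw [mem_imTauP]
  refine ⟨QuotientGroup.mk ⟨σ, hσP⟩, congrArg Multiplicative.ofAdd ?_⟩
  change johnsonElem ⟨σ, hσA⟩ = _
  refine linearMap_H_ext fun i => ?_
  rw [LinearMap.sum_apply, Finset.sum_eq_single i, conjDer_apply, elem, LinearMap.smulRight_apply,
    xDual_x, if_pos rfl, one_smul, ← hgc, adR_cls,
    ← cls_conj (comm_mem_Gam (hg i) _) (FreeGroup.of i)⁻¹]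
  · exact cls_congr _ ((congrArg _ (hσ i)).trans (inv_mul_conj_eq _ _))
  · intro m _ hm
    rw [conjDer_apply, elem, LinearMap.smulRight_apply, xDual_x, if_neg hm.symm, zero_smul]
  · simp

end Derivations

/-! ## The trace on words -/

section WordTrace

variable {n : ℕ} {j : Fin n}

variable (j) in
/-- Combinations of pairs `(s, t)`, standing for the words `s x_j t`. -/
abbrev Z : Type := (List (Letter j) × List (Letter j)) →₀ ℤ

/-- `(s, t) ↦ s x_j t b - b s x_j t`. -/
def zR (b : Letter j) : Z j →ₗ[ℤ] Z j :=
  Finsupp.linearCombination ℤ fun q =>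
    Finsupp.single (q.1, q.2 ++ [b]) 1 - Finsupp.single (b :: q.1, q.2) 1

/-- `(s, t) ↦ s [a, x_j] t`. -/
def zD (a : Letter j) : Z j →ₗ[ℤ] Z j :=
  Finsupp.linearCombination ℤ fun q =>
    Finsupp.single (q.1 ++ [a], q.2) 1 - Finsupp.single (q.1, a :: q.2) 1

theorem zR_single (b : Letter j) (s t : List (Letter j)) :
    zR b (Finsupp.single (s, t) 1) =
      Finsupp.single (s, t ++ [b]) 1 - Finsupp.single (b :: s, t) 1 := by
  simp [zR]

theorem zD_single (a : Letter j) (s t : List (Letter j)) :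
    zD a (Finsupp.single (s, t) 1) =
      Finsupp.single (s ++ [a], t) 1 - Finsupp.single (s, a :: t) 1 := by
  simp [zD]

/-- `zR` adds a letter at an outer end of `s x_j t`, `zD` adds one next to `x_j`. -/
theorem zR_zD (a b : Letter j) (y : Z j) : zR b (zD a y) = zD a (zR b y) := by
  have : zR b ∘ₗ zD a = zD a ∘ₗ zR b := by
    refine Finsupp.lhom_ext' fun ⟨s, t⟩ => LinearMap.ext_ring ?_
    simp only [LinearMap.comp_apply, Finsupp.lsingle_apply, zD_single, zR_single, map_sub,
      List.cons_append]
    abel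
  exact LinearMap.congr_fun this y

/-- Iterated right bracketing. -/
def zFold (y : Z j) (u : List (Letter j)) : Z j := u.foldl (fun y b => zR b y) y

theorem zFold_neg_zD (a : Letter j) (u : List (Letter j)) :
    ∀ y : Z j, zFold (-zD a y) u = -zD a (zFold y u) := by
  induction u with
  | nil => exact fun y => rfl
  | cons b u ih =>
    intro y
    change zFold (zR b (-zD a y)) u = -zD a (zFold (zR b y) u)
    rw [map_neg, zR_zD, ih]

/-- The tensor `[x_j, u]` in terms of the words `s x_j t`. -/
def zWord (u : List (Letter j)) : Z j := zFold (Finsupp.single ([], []) 1) u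

theorem zWord_append (u : List (Letter j)) (b : Letter j) :
    zWord (u ++ [b]) = zR b (zWord u) := by
  simp [zWord, zFold]

/-- The innermost bracket `[x_j, a]` is `-zD a` applied to `x_j`, and `zD` commutes with all later
right bracketings. This is the tensor counterpart of `delta_bracket_jWord`. -/
theorem zWord_cons (a : Letter j) (u : List (Letter j)) :
    zWord (a :: u) = -zD a (zWord u) := by
  rw [zWord, zWord, ← zFold_neg_zD, zD_single, neg_sub]
  change zFold (zR a _) u = _
  rw [zR_single]
  rfl

/-- `zWord` as a linear map. -/
def zU (k : ℕ) : U j k →ₗ[ℤ] Z j := Finsupp.linearCombination ℤ fun u => zWord (List.ofFn u)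

theorem zU_single {k : ℕ} (u : Fin k → Letter j) :
    zU k (Finsupp.single u 1) = zWord (List.ofFn u) := by
  simp [zU]

theorem ofFn_snoc_eq {β : Type*} {k : ℕ} (u : Fin k → β) (b : β) :
    List.ofFn (Fin.snoc (α := fun _ => β) u b) = List.ofFn u ++ [b] := by
  rw [List.ofFn_succ', List.concat_eq_append]
  simp

theorem zU_snocU (a : Letter j) {k : ℕ} (v : U j k) : zU (k + 1) (snocU a k v) = zR a (zU k v) := by
  have : zU (k + 1) ∘ₗ snocU a k = zR a ∘ₗ zU k := by
    refine Finsupp.lhom_ext' fun u => LinearMap.ext_ring ?_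
    simp only [LinearMap.comp_apply, Finsupp.lsingle_apply, snocU_single, zU_single, ofFn_snoc_eq,
      zWord_append]
  exact LinearMap.congr_fun this v

theorem zU_consU (a : Letter j) {k : ℕ} (v : U j k) :
    zU (k + 1) (consU a k v) = -zD a (zU k v) := by
  have : zU (k + 1) ∘ₗ consU a k = -(zD a ∘ₗ zU k) := by
    refine Finsupp.lhom_ext' fun u => LinearMap.ext_ring ?_
    simp only [LinearMap.comp_apply, Finsupp.lsingle_apply, consU_single, zU_single,
      LinearMap.neg_apply, ← zWord_cons]
    congr 1
    rw [List.ofFn_succ]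
    simp
  exact LinearMap.congr_fun this v

/-- The first letter of the word `s x_j`. -/
def firstLetter : List (Letter j) → Fin n
  | [] => j
  | h :: _ => h

/-- On words `s x_j t` beginning with `x_m`: the word `t s` read cyclically after `x_j`. -/
def wTr (m : Fin n) : Z j →ₗ[ℤ] (List (Letter j) →₀ ℤ) :=
  Finsupp.linearCombination ℤ fun q =>
    if firstLetter q.1 = m then Finsupp.single (q.2 ++ q.1) 1 else 0

theorem wTr_single (m : Fin n) (s t : List (Letter j)) :
    wTr m (Finsupp.single (s, t) 1) =
      if firstLetter s = m then Finsupp.single (t ++ s) 1 else 0 := by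
  simp [wTr]

/-- Appending a letter to a word. -/
def appR (a : Letter j) : (List (Letter j) →₀ ℤ) →ₗ[ℤ] (List (Letter j) →₀ ℤ) :=
  Finsupp.lmapDomain ℤ ℤ fun u => u ++ [a]

/-- Prepending a letter to a word. -/
def appL (a : Letter j) : (List (Letter j) →₀ ℤ) →ₗ[ℤ] (List (Letter j) →₀ ℤ) :=
  Finsupp.lmapDomain ℤ ℤ fun u => a :: u

theorem appR_single (a : Letter j) (u : List (Letter j)) :
    appR a (Finsupp.single u 1) = Finsupp.single (u ++ [a]) 1 := by
  simp [appR]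

theorem appL_single (a : Letter j) (u : List (Letter j)) :
    appL a (Finsupp.single u 1) = Finsupp.single (a :: u) 1 := by
  simp [appL]

/-- A letter inserted just before `x_j` ends the cyclic reading `t s`, one inserted just after
begins it. The correction terms come from empty `s`, where the new word `a x_j t` begins with `a`
instead of `x_j`. -/
theorem wTr_zD (m : Fin n) (a : Letter j) (y : Z j) :
    wTr m (zD a y) = appR a (wTr m y) - appL a (wTr m y) +
      ((if m = (a : Fin n) then appR a (wTr j y) else 0) -
        if m = j then appR a (wTr j y) else 0) := by
  have : wTr m ∘ₗ zD a = appR a ∘ₗ wTr m - appL a ∘ₗ wTr m +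
      ((if m = (a : Fin n) then appR a ∘ₗ wTr j else 0) -
        if m = j then appR a ∘ₗ wTr j else 0) := by
    refine Finsupp.lhom_ext' fun ⟨s, t⟩ => LinearMap.ext_ring ?_
    have ha := a.2
    rcases s with - | ⟨h, s⟩
    · by_cases h1 : m = j
      · subst h1
        simp [zD_single, wTr_single, firstLetter, a.2, a.2.symm, appR_single, appL_single]
        abel
      · by_cases h2 : m = (a : Fin n)
        · subst h2
          simp [zD_single, wTr_single, firstLetter, a.2, a.2.symm, appR_single]
        · simp [zD_single, wTr_single, firstLetter, h1, h2, Ne.symm h1, Ne.symm h2]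
    · have e1 : wTr j (Finsupp.single (h :: s, t) 1) = 0 := by
        simp [wTr_single, firstLetter, h.2]
      have e2 : ∀ f : (List (Letter j) →₀ ℤ) →ₗ[ℤ] (List (Letter j) →₀ ℤ),
          (f ∘ₗ wTr j) (Finsupp.single (h :: s, t) 1) = 0 := fun f => by
        rw [LinearMap.comp_apply, e1, map_zero]
      by_cases h1 : (h : Fin n) = m
      · have h2 : m ≠ j := h1 ▸ h.2
        by_cases h3 : m = (a : Fin n)
        · simp [zD_single, wTr_single, firstLetter, h1, h3, appR_single, appL_single, a.2]
        · simp [zD_single, wTr_single, firstLetter, h1, h2, h3, appR_single, appL_single]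
      · by_cases h2 : m = j <;> by_cases h3 : m = (a : Fin n) <;>
          simp [zD_single, wTr_single, firstLetter, h1, h2, h3, h.2]
        all_goals simp_all
  have h := LinearMap.congr_fun this y
  split_ifs at h ⊢ <;> exact h

theorem wTr_zR (a : Letter j) (y : Z j) : wTr j (zR a y) = appR a (wTr j y) := by
  have : wTr j ∘ₗ zR a = appR a ∘ₗ wTr j := by
    refine Finsupp.lhom_ext' fun ⟨s, t⟩ => LinearMap.ext_ring ?_
    rcases s with - | ⟨h, s⟩
    · simp [zR_single, wTr_single, firstLetter, a.2, appR_single]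
    · simp [zR_single, wTr_single, firstLetter, a.2, h.2]
  exact LinearMap.congr_fun this y

/-- Among the words in the expansion of `[x_j, u]`, only `x_j u` begins with `x_j`. -/
theorem wTr_zWord (u : List (Letter j)) : wTr j (zWord u) = Finsupp.single u 1 := by
  induction u using List.reverseRecOn with
  | nil => simp [zWord, zFold, wTr_single, firstLetter]
  | append_singleton u a ih => rw [zWord_append, wTr_zR, ih, appR_single]

/-- The tuple is the one produced by `Realizes.commutator`. In position `j` the bracket of `y_j`
cancels the correction from `wTr_zD`, and the bracket of `y_a` cancels the correction in position
`a`. -/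
theorem sum_wTr_commutator (a : Letter j) (y : Fin n → Z j) :
    ∑ m, wTr m (zD a (y m) + if m = j then zR a (y j) - zR a (y a) else 0) =
      appR a (∑ m, wTr m (y m)) - appL a (∑ m, wTr m (y m)) := by
  have h : ∀ m, wTr m (zD a (y m) + if m = j then zR a (y j) - zR a (y a) else 0) =
      (appR a (wTr m (y m)) - appL a (wTr m (y m))) +
        ((if m = (a : Fin n) then appR a (wTr j (y a)) else 0) -
          if m = j then appR a (wTr j (y a)) else 0) := by
    intro m
    by_cases hm : m = j
    · subst hm
      simp [wTr_zD, wTr_zR, a.2.symm]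
      abel
    · by_cases hm' : m = (a : Fin n)
      · subst hm'
        simp [wTr_zD, a.2]
      · simp [wTr_zD, hm, hm']
  simp [h, Finset.sum_add_distrib, Finset.sum_sub_distrib, map_sum]

end WordTrace

/-! ## Realizable tuples of vanishing trace -/

section Realizable

variable {n : ℕ} {j : Fin n}

/-- Tuples of combinations of words `u` such that the tuple of the brackets `[x_j, u]` is realized
by an automorphism and has vanishing trace. -/
def TraceFree (k : ℕ) (v : Fin n → U j k) : Prop :=
  Realizes k (fun m => br j k (v m)) ∧ ∑ m, wTr m (zU k (v m)) = 0

theorem TraceFree.commutator {k : ℕ} {v : Fin n → U j k} (hv : TraceFree k v) (a : Letter j) :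
    TraceFree (k + 1) fun m => -consU a k (v m) +
      if m = j then snocU a k (v j) - snocU a k (v a) else 0 := by
  refine ⟨?_, ?_⟩
  · convert hv.1.commutator j a a.2 using 2 with m
    rw [delta_br, map_add, map_neg]
    split_ifs
    · rw [map_sub, br_snocU, br_snocU]
    · rw [map_zero]
  · have h := sum_wTr_commutator a fun m => zU k (v m)
    rw [hv.2, map_zero, map_zero, sub_zero] at h
    rw [← h]
    refine Finset.sum_congr rfl fun m _ => congrArg _ ?_
    rw [map_add, map_neg, zU_consU, neg_neg]
    split_ifs
    · rw [map_sub, zU_snocU, zU_snocU]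
    · rw [map_zero]

/-- Commutators with `conjAut j a` are applied to `x_i ↦ x_j x_i x_j⁻¹`, with `a` running through
`u` from its last letter to its first. Away from position `j` each of them only prepends `a` with a
sign. -/
theorem exists_traceFree {i : Fin n} (hi : i ≠ j) : ∀ (k : ℕ) (u : Fin k → Letter j),
    ∃ v : Fin n → U j k, TraceFree k v ∧ v i = (-1 : ℤ) ^ k • Finsupp.single u 1 ∧
      ∀ m, m ≠ i → m ≠ j → v m = 0
  | 0, u => by
    refine ⟨fun m => if m = i then Finsupp.single u 1 else 0, ⟨?_, ?_⟩, by simp,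
      fun m hm _ => if_neg hm⟩
    · convert realizes_conjAut i j hi.symm using 2 with m
      beta_reduce
      split_ifs
      · rw [br_single]
        rfl
      · rw [map_zero]
    · rw [Finset.sum_eq_single i]
      · beta_reduce
        rw [if_pos rfl, zU_single]
        simp [zWord, zFold, wTr_single, firstLetter, hi.symm]
      · intro m _ hm
        beta_reduce
        rw [if_neg hm, map_zero, map_zero]
      · simp
  | k + 1, u => by
    obtain ⟨v, hv, hvi, hv0⟩ := exists_traceFree hi k (Fin.tail u)
    refine ⟨_, hv.commutator (u 0), ?_, fun m hm hm' => ?_⟩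
    · simp only [if_neg hi, add_zero, hvi, map_smul, consU_single]
      rw [Fin.cons_self_tail, pow_succ, mul_neg_one, neg_smul]
    · simp only [if_neg hm', add_zero, hv0 m hm hm', map_zero, neg_zero]

/-- Modulo the image of the Johnson homomorphism, each sum of derivations
`x_m^* ⊗ [c_m, x_m]` with `c_m` linear in `x_j` is a single derivation `x_j^* ⊗ [c, x_j]` with the
same trace. -/
theorem exists_sub_mem_imTauP (k : ℕ) (hk : 1 ≤ k + 1) (c : Fin n → U j k) :
    ∃ v : U j k, ∑ m, conjDer m k (br j k (c m)) - conjDer j k (br j k v) ∈ imTauP n (k + 1) hk ∧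
      ∑ m, wTr m (zU k (c m)) = wTr j (zU k v) := by
  -- The property is linear in `c`, so it suffices to check it for one word in one position.
  let N : Submodule ℤ (Fin n → U j k) :=
    { carrier := {c | ∃ v : U j k, ∑ m, conjDer m k (br j k (c m)) - conjDer j k (br j k v) ∈
        imTauP n (k + 1) hk ∧ ∑ m, wTr m (zU k (c m)) = wTr j (zU k v)}
      zero_mem' := ⟨0, by simp, by simp⟩
      add_mem' := by
        rintro c d ⟨v, hv, hv'⟩ ⟨w, hw, hw'⟩
        refine ⟨v + w, ?_, ?_⟩
        · have := Submodule.add_mem _ hv hw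
          simp only [Pi.add_apply, map_add, Finset.sum_add_distrib]
          convert this using 1
          abel
        · simp only [Pi.add_apply, map_add, Finset.sum_add_distrib, hv', hw']
      smul_mem' := by
        rintro r c ⟨v, hv, hv'⟩
        refine ⟨r • v, ?_, ?_⟩
        · have := Submodule.smul_mem _ r hv
          simpa only [Pi.smul_apply, map_smul, ← Finset.smul_sum, ← smul_sub] using this
        · simp only [Pi.smul_apply, map_smul, ← Finset.smul_sum, hv'] }
  have hsum : ∀ {M M' : Type} [AddCommGroup M] [AddCommGroup M'] (f : Fin n → M' →ₗ[ℤ] M)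
      (g : U j k →ₗ[ℤ] M') (i : Fin n) (w : U j k),
      ∑ m, f m (g ((Pi.single i w : Fin n → U j k) m)) = f i (g w) := by
    intro M M' _ _ f g i w
    rw [Finset.sum_eq_single i]
    · rw [Pi.single_eq_same]
    · intro m _ hm
      rw [Pi.single_eq_of_ne hm, map_zero, map_zero]
    · simp
  have hsum' : ∀ {M M' : Type} [AddCommGroup M] [AddCommGroup M'] (f : Fin n → M' →ₗ[ℤ] M)
      (g : U j k →ₗ[ℤ] M') (i : Fin n) (_ : i ≠ j) (w : Fin n → U j k)
      (_ : ∀ m, m ≠ i → m ≠ j → w m = 0),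
      ∑ m, f m (g (w m)) = f i (g (w i)) + f j (g (w j)) := by
    intro M M' _ _ f g i hij w hw
    rw [← Finset.sum_subset (Finset.subset_univ {i, j}), Finset.sum_pair hij]
    intro m _ hm
    simp only [Finset.mem_insert, Finset.mem_singleton, not_or] at hm
    rw [hw m hm.1 hm.2, map_zero, map_zero]
  have hword : ∀ (i : Fin n) (u : Fin k → Letter j),
      (Pi.single i (Finsupp.single u 1) : Fin n → U j k) ∈ N := by
    intro i u
    by_cases hij : i = j
    · subst hij
      refine ⟨Finsupp.single u 1, ?_, ?_⟩
      · rw [hsum (fun m => conjDer m k) (br i k) i]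
        simp
      · exact hsum (fun m => wTr m) (zU k) i _
    · obtain ⟨v, ⟨hv, hv'⟩, hvi, hv0⟩ := exists_traceFree hij k u
      have h1 := hv.sum_conjDer_mem_imTauP hk
      rw [hsum' (fun m => conjDer m k) (br j k) i hij v hv0] at h1
      rw [hsum' (fun m => wTr m) (zU k) i hij v hv0] at hv'
      -- The trace-free tuple lives in positions `i` and `j`, so its entry at `i` can be traded for
      -- `-v j` at `j`, both modulo the image and for the trace.
      have h2 : (-1 : ℤ) ^ k • (Pi.single i (Finsupp.single u 1) : Fin n → U j k) ∈ N := by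
        rw [← Pi.single_smul', ← hvi]
        refine ⟨-v j, ?_, ?_⟩
        · rw [hsum (fun m => conjDer m k) (br j k) i]
          simpa using h1
        · rw [hsum (fun m => wTr m) (zU k) i, map_neg, map_neg]
          exact eq_neg_of_add_eq_zero_left hv'
      have h3 := N.smul_mem ((-1 : ℤ) ^ k) h2
      rwa [smul_smul, ← mul_pow, neg_one_mul, neg_neg, one_pow, one_smul] at h3
  have hsingle : ∀ (i : Fin n) (w : U j k), (Pi.single i w : Fin n → U j k) ∈ N := by
    intro i w
    induction w using Finsupp.induction_linear with
    | zero => rw [Pi.single_zero]; exact N.zero_mem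
    | add w w' h h' => rw [Pi.single_add]; exact N.add_mem h h'
    | single u r =>
      have := N.smul_mem r (hword i u)
      rwa [← Pi.single_smul', Finsupp.smul_single, smul_eq_mul, mul_one] at this
  have : c ∈ N := by
    rw [← Finset.univ_sum_single c]
    exact N.sum_mem fun i _ => hsingle i _
  exact this

end Realizable

/-! ## The trace map in terms of words -/

section TensorWords

variable {n : ℕ}

variable (n) in
/-- The free associative ring on the letters `x_1, …, x_n`. -/
abbrev W : Type := MonoidAlgebra ℤ (FreeMonoid (Fin n))

/-- A word as an element of the free associative ring. -/
def wd (l : List (Fin n)) : W n := MonoidAlgebra.single (FreeMonoid.ofList l) 1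

theorem wd_mul (l l' : List (Fin n)) : wd l * wd l' = wd (l ++ l') := by
  simp [wd, MonoidAlgebra.single_mul_single]

/-- The linear map with prescribed values on words. -/
def wLin {M : Type*} [AddCommGroup M] (f : List (Fin n) → M) : W n →ₗ[ℤ] M :=
  Finsupp.linearCombination ℤ (fun l : FreeMonoid (Fin n) => f l.toList) ∘ₗ
    (MonoidAlgebra.coeffAddEquiv (R := ℤ) (M := FreeMonoid (Fin n))).toAddMonoidHom.toIntLinearMap

theorem wLin_wd {M : Type*} [AddCommGroup M] (f : List (Fin n) → M) (l : List (Fin n)) :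
    wLin f (wd l) = f l := by
  simp [wLin, wd]

theorem W_ext {M : Type*} [AddCommGroup M] {f g : W n →ₗ[ℤ] M} (h : ∀ l, f (wd l) = g (wd l)) :
    f = g := by
  refine LinearMap.ext fun y => ?_
  induction y using MonoidAlgebra.induction_linear with
  | zero => rw [map_zero, map_zero]
  | add a b ha hb => rw [map_add, map_add, ha, hb]
  | single m r =>
    have : MonoidAlgebra.single m r = r • wd (n := n) m.toList := by
      simp [wd]
    rw [this, map_smul, map_smul, h]

/-- The linear map `H → W` with `x_i ↦ x_i`. -/
def hW : H n →ₗ[ℤ] W n := ∑ i, (xDual i).smulRight (wd [i])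

theorem hW_apply (h : H n) : hW h = ∑ i, xDual i h • wd [i] := by
  simp [hW]

theorem hW_x (i : Fin n) : hW (x i) = wd [i] := by
  simp [hW_apply, xDual_x]

/-- The algebra map `T(H) → W`. -/
def psi : T n →ₐ[ℤ] W n := TensorAlgebra.lift ℤ hW

theorem psi_ι (h : H n) : psi (TensorAlgebra.ι ℤ h) = hW h := by
  simp [psi]

/-- The linear map `H^{⊗k} → W`. -/
def tensorW (k : ℕ) : (⨂[ℤ]^k (H n)) →ₗ[ℤ] W n :=
  psi.toLinearMap ∘ₗ TensorPower.toTensorAlgebra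

theorem tensorW_apply {k : ℕ} (z : ⨂[ℤ]^k (H n)) :
    tensorW k z = psi (TensorPower.toTensorAlgebra z) := rfl

theorem tensorW_tprod {k : ℕ} (a : Fin k → H n) :
    tensorW k (PiTensorProduct.tprod ℤ a) = (List.ofFn fun i => hW (a i)).prod := by
  rw [tensorW_apply, TensorPower.toTensorAlgebra_tprod, TensorAlgebra.tprod_apply, map_list_prod,
    List.map_ofFn]
  simp only [Function.comp_def, psi_ι]

/-- Deletion of the first letter, when it is `x_m`. -/
def strip (m : Fin n) : W n →ₗ[ℤ] W n :=
  wLin fun l => match l with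
    | [] => 0
    | h :: t => if h = m then wd t else 0

theorem strip_cons (m h : Fin n) (t : List (Fin n)) :
    strip m (wd (h :: t)) = if h = m then wd t else 0 := wLin_wd _ _

theorem strip_wd_mul (m i : Fin n) (y : W n) :
    strip m (wd [i] * y) = if i = m then y else 0 := by
  have : strip m ∘ₗ LinearMap.mulLeft ℤ (wd [i]) = if i = m then LinearMap.id else 0 :=
    W_ext fun l => by
      rw [LinearMap.comp_apply, LinearMap.mulLeft_apply, wd_mul, List.singleton_append, strip_cons]
      split_ifs <;> rfl
  have h := LinearMap.congr_fun this y
  rw [LinearMap.comp_apply, LinearMap.mulLeft_apply] at h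
  rw [h]
  split_ifs <;> rfl

theorem strip_hW_mul (m : Fin n) (h : H n) (y : W n) : strip m (hW h * y) = xDual m h • y := by
  simp only [hW_apply, Finset.sum_mul, smul_mul_assoc, map_sum, map_smul, strip_wd_mul, smul_ite,
    smul_zero]
  simp

theorem tensorW_contract {k : ℕ} (m : Fin n) (z : ⨂[ℤ]^(k + 1) (H n)) :
    tensorW k (contract n k m z) = strip m (tensorW (k + 1) z) := by
  have : tensorW k ∘ₗ contract n k m = strip m ∘ₗ tensorW (k + 1) := by
    refine PiTensorProduct.ext (MultilinearMap.ext fun a => ?_)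
    simp only [LinearMap.compMultilinearMap_apply, LinearMap.comp_apply]
    rw [contract, PiTensorProduct.lift.tprod, tensorW_tprod, List.ofFn_succ, List.prod_cons,
      strip_hW_mul, LinearMap.uncurryLeft_apply, LinearMap.smulRight_apply,
      smul_apply, map_smul, tensorW_tprod]
    rfl
  exact LinearMap.congr_fun this z

/-- The map from words to cyclic words. -/
def cyc : W n →ₗ[ℤ] (Cycle (Fin n) →₀ ℤ) := wLin fun l => Finsupp.single (l : Cycle (Fin n)) 1

theorem cyc_wd (l : List (Fin n)) : cyc (wd l) = Finsupp.single (l : Cycle (Fin n)) 1 :=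
  wLin_wd _ _

theorem cyc_wd_mul (i : Fin n) (y : W n) : cyc (wd [i] * y) = cyc (y * wd [i]) := by
  have : cyc ∘ₗ LinearMap.mulLeft ℤ (wd [i]) = cyc ∘ₗ LinearMap.mulRight ℤ (wd [i]) :=
    W_ext fun l => by
      simp only [LinearMap.comp_apply, LinearMap.mulLeft_apply, LinearMap.mulRight_apply, wd_mul,
        cyc_wd]
      rw [Cycle.coe_eq_coe.mpr List.isRotated_append]
  exact LinearMap.congr_fun this y

theorem cyc_hW_mul (h : H n) (y : W n) : cyc (hW h * y) = cyc (y * hW h) := by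
  simp only [hW_apply, Finset.sum_mul, Finset.mul_sum, map_sum, smul_mul_assoc, mul_smul_comm,
    map_smul, cyc_wd_mul]

/-- The map from the cyclic coinvariants to combinations of cyclic words. -/
def cycC (k : ℕ) : C n k →ₗ[ℤ] (Cycle (Fin n) →₀ ℤ) :=
  (cyclicRel n k).liftQ (cyc ∘ₗ tensorW k) <| by
    rw [cyclicRel, Submodule.span_le]
    rintro _ ⟨a, rfl⟩
    rw [SetLike.mem_coe, LinearMap.mem_ker, map_sub, sub_eq_zero, LinearMap.comp_apply,
      LinearMap.comp_apply]
    rcases k with - | k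
    · congr 2
    · have e : (fun l => a (finRotate (k + 1) l)) =
          Fin.snoc (α := fun _ => H n) (Fin.tail a) (a 0) := by
        rw [Fin.snoc_eq_cons_rotate, Fin.cons_self_tail]
      have e' : (List.ofFn fun i => hW (Fin.snoc (α := fun _ => H n) (Fin.tail a) (a 0) i)) =
          (List.ofFn fun i => hW (Fin.tail a i)) ++ [hW (a 0)] := by
        rw [← ofFn_snoc_eq]
        congr 1
        exact Fin.comp_snoc (fun h => hW h) (Fin.tail a) (a 0)
      rw [e, tensorW_tprod, tensorW_tprod, e', List.ofFn_succ, List.prod_cons, List.prod_append,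
        List.prod_singleton, cyc_hW_mul]
      rfl

theorem cycC_mkQ {k : ℕ} (z : ⨂[ℤ]^k (H n)) :
    cycC k ((cyclicRel n k).mkQ z) = cyc (tensorW k z) := rfl

theorem toDirectSum_toTensorAlgebra {k : ℕ} (z : ⨂[ℤ]^k (H n)) :
    TensorAlgebra.toDirectSum (TensorPower.toTensorAlgebra z) =
      DirectSum.of (fun m => ⨂[ℤ]^m (H n)) k z := by
  rw [← TensorAlgebra.toDirectSum_ofDirectSum (DirectSum.of (fun m => ⨂[ℤ]^m (H n)) k z)]
  congr 1
  exact (DirectSum.toAddMonoid_of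
    (fun _ => LinearMap.toAddMonoidHom TensorPower.toTensorAlgebra) _ _).symm

theorem ι_mul_mem_range {k : ℕ} (h : H n) (y : T n)
    (hy : y ∈ LinearMap.range (TensorPower.toTensorAlgebra (R := ℤ) (M := H n) (n := k))) :
    TensorAlgebra.ι ℤ h * y ∈
      LinearMap.range (TensorPower.toTensorAlgebra (R := ℤ) (M := H n) (n := k + 1)) := by
  obtain ⟨z, rfl⟩ := hy
  induction z using PiTensorProduct.induction_on with
  | smul_tprod r a =>
    rw [map_smul, mul_smul_comm]
    refine Submodule.smul_mem _ _ ⟨PiTensorProduct.tprod ℤ (Fin.cons (α := fun _ => H n) h a), ?_⟩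
    rw [TensorPower.toTensorAlgebra_tprod, TensorPower.toTensorAlgebra_tprod,
      TensorAlgebra.tprod_apply, TensorAlgebra.tprod_apply, List.ofFn_succ, List.prod_cons]
    simp
  | add a b ha hb =>
    rw [map_add, mul_add]
    exact Submodule.add_mem _ ha hb

theorem mul_ι_mem_range {k : ℕ} (h : H n) (y : T n)
    (hy : y ∈ LinearMap.range (TensorPower.toTensorAlgebra (R := ℤ) (M := H n) (n := k))) :
    y * TensorAlgebra.ι ℤ h ∈
      LinearMap.range (TensorPower.toTensorAlgebra (R := ℤ) (M := H n) (n := k + 1)) := by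
  obtain ⟨z, rfl⟩ := hy
  induction z using PiTensorProduct.induction_on with
  | smul_tprod r a =>
    rw [map_smul, smul_mul_assoc]
    refine Submodule.smul_mem _ _ ⟨PiTensorProduct.tprod ℤ (Fin.snoc (α := fun _ => H n) a h), ?_⟩
    rw [TensorPower.toTensorAlgebra_tprod, TensorPower.toTensorAlgebra_tprod,
      TensorAlgebra.tprod_apply, TensorAlgebra.tprod_apply, List.ofFn_succ', List.concat_eq_append,
      List.prod_append]
    simp
  | add a b ha hb =>
    rw [map_add, add_mul]
    exact Submodule.add_mem _ ha hb

theorem iotaT_adR (b : Fin n) {k : ℕ} (c : L n (k + 1)) :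
    iotaT n (k + 1) (adR b k c) = iotaT n k c * TensorAlgebra.ι ℤ (x b) -
      TensorAlgebra.ι ℤ (x b) * iotaT n k c := by
  obtain ⟨g, hg, rfl⟩ := exists_cls c
  rw [adR_cls, ← iotaT_generator]
  exact iotaT_commutator _ _ hg

/-- Brackets are homogeneous in `T(H)`, so the projection to one degree in `iota` loses nothing. -/
theorem iotaT_bracket_mem_range : ∀ (k : ℕ) (w : Fin (k + 1) → Fin n),
    iotaT n k (bracket n k w) ∈
      LinearMap.range (TensorPower.toTensorAlgebra (R := ℤ) (M := H n) (n := k + 1))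
  | 0, w => by
    refine ⟨PiTensorProduct.tprod ℤ fun _ => x (w 0), ?_⟩
    refine Eq.trans ?_ (iotaT_generator (w 0)).symm
    simp
  | k + 1, w => by
    rw [← Fin.snoc_init_self (α := fun _ => Fin n) w, bracket_snoc, iotaT_adR]
    exact Submodule.sub_mem _ (mul_ι_mem_range _ _ (iotaT_bracket_mem_range k _))
      (ι_mul_mem_range _ _ (iotaT_bracket_mem_range k _))

theorem tensorW_iota_bracket {k : ℕ} (w : Fin (k + 1) → Fin n) :
    tensorW (k + 1) (iota n k (bracket n k w)) = psi (iotaT n k (bracket n k w)) := by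
  obtain ⟨z, hz⟩ := iotaT_bracket_mem_range k w
  rw [tensorW_apply, iota, LinearMap.comp_apply, LinearMap.comp_apply, ← hz,
    AlgHom.toLinearMap_apply, toDirectSum_toTensorAlgebra]
  congr 2
  exact DirectSum.of_eq_same (β := fun m => ⨂[ℤ]^m (H n)) (k + 1) z

theorem Phi_elem {k : ℕ} (m : Fin n) (y : L n (k + 1)) :
    Phi n k (elem m y) = contract n k m (iota n k y) := by
  rw [Phi, LinearMap.sum_apply, Finset.sum_eq_single m]
  · simp [elem, xDual_x]
  · intro i _ hi
    simp [elem, xDual_x, hi]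
  · simp

variable {j : Fin n}

/-- `(s, t) ↦ s x_j t`. -/
def jW : Z j →ₗ[ℤ] W n :=
  Finsupp.linearCombination ℤ fun q =>
    wd (q.1.map (fun b : Letter j => (b : Fin n)) ++ j :: q.2.map fun b : Letter j => (b : Fin n))

theorem jW_single (s t : List (Letter j)) :
    jW (Finsupp.single (s, t) 1) =
      wd (s.map (fun b : Letter j => (b : Fin n)) ++ j :: t.map fun b : Letter j => (b : Fin n)) := by
  simp [jW]

theorem jW_zR (b : Letter j) (y : Z j) :
    jW (zR b y) = jW y * wd [(b : Fin n)] - wd [(b : Fin n)] * jW y := by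
  have : jW ∘ₗ zR b = LinearMap.mulRight ℤ (wd [(b : Fin n)]) ∘ₗ jW -
      LinearMap.mulLeft ℤ (wd [(b : Fin n)]) ∘ₗ jW := by
    refine Finsupp.lhom_ext' fun ⟨s, t⟩ => LinearMap.ext_ring ?_
    simp only [LinearMap.comp_apply, LinearMap.sub_apply, Finsupp.lsingle_apply, zR_single, map_sub,
      jW_single, LinearMap.mulLeft_apply, LinearMap.mulRight_apply, wd_mul]
    simp
  exact LinearMap.congr_fun this y

theorem psi_iotaT_bracket : ∀ (k : ℕ) (u : Fin k → Letter j),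
    psi (iotaT n k (bracket n k (jWord j u))) = jW (zWord (List.ofFn u))
  | 0, u => by
    refine (congrArg psi (iotaT_generator j)).trans ?_
    rw [psi_ι, hW_x]
    simp [zWord, zFold, jW_single]
  | k + 1, u => by
    rw [← Fin.snoc_init_self (α := fun _ => Letter j) u, jWord_snoc, bracket_snoc, iotaT_adR,
      map_sub, map_mul, map_mul, psi_ι, hW_x, psi_iotaT_bracket k, ofFn_snoc_eq, zWord_append,
      jW_zR]

/-- For nonempty `u`, `[x_j, u]` is a commutator with a letter, which rotation kills. -/
theorem cyc_jW_zU {k : ℕ} (v : U j (k + 1)) : cyc (jW (zU (k + 1) v)) = 0 := by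
  have : cyc ∘ₗ jW ∘ₗ zU (j := j) (k + 1) = 0 := by
    refine Finsupp.lhom_ext' fun u => LinearMap.ext_ring ?_
    simp only [LinearMap.comp_apply, Finsupp.lsingle_apply, zU_single]
    rw [← Fin.snoc_init_self (α := fun _ => Letter j) u, ofFn_snoc_eq, zWord_append, jW_zR,
      map_sub, cyc_wd_mul, sub_self]
    rfl
  exact LinearMap.congr_fun this v

variable (j) in
/-- The cyclic word `x_j u`. -/
def jCycle (u : List (Letter j)) : Cycle (Fin n) :=
  ((j :: u.map fun b : Letter j => (b : Fin n) : List (Fin n)) : Cycle (Fin n))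

/-- `x_j` occurs once in `x_j u`, so only the trivial rotations begin with `x_j`. -/
theorem jCycle_injective : Function.Injective (jCycle j) := by
  intro u v h
  obtain ⟨m, hm, h⟩ := List.isRotated_iff_mod.mp (Cycle.coe_eq_coe.mp h)
  have key : j :: u.map (fun b : Letter j => (b : Fin n)) =
      j :: v.map fun b : Letter j => (b : Fin n) := by
    rcases hm.lt_or_eq with hm | rfl
    · rcases m with - | m
      · simpa using h
      · have h' := List.head?_rotate hm
        rw [h, List.head?_cons, List.getElem?_cons_succ, eq_comm] at h'
        have h2 := List.mem_of_getElem? h'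
        obtain ⟨b, _, hb⟩ := List.mem_map.mp h2
        exact absurd hb b.2
    · rwa [List.rotate_length] at h
  exact List.map_injective_iff.mpr Subtype.val_injective (List.cons.inj key).2

/-- If `s = x_m s'`, deleting the first letter of `s x_j t x_m` leaves `s' x_j t x_m`, a rotation of
`x_j t s`. If `s` is empty and `m = j`, it leaves `t x_j`, a rotation of `x_j t`. -/
theorem cyc_strip_jW_mul (m : Fin n) (y : Z j) :
    cyc (strip m (jW y * wd [m])) = Finsupp.lmapDomain ℤ ℤ (jCycle j) (wTr m y) := by
  have : cyc ∘ₗ strip m ∘ₗ LinearMap.mulRight ℤ (wd [m]) ∘ₗ jW =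
      Finsupp.lmapDomain ℤ ℤ (jCycle j) ∘ₗ wTr m := by
    refine Finsupp.lhom_ext' fun ⟨s, t⟩ => LinearMap.ext_ring ?_
    simp only [LinearMap.comp_apply, Finsupp.lsingle_apply, jW_single, wTr_single,
      LinearMap.mulRight_apply, wd_mul]
    by_cases hm : firstLetter s = m
    · rw [if_pos hm, Finsupp.lmapDomain_apply, Finsupp.mapDomain_single, jCycle]
      rcases s with - | ⟨h, s⟩
      · change j = m at hm
        rw [List.map_nil, List.nil_append, List.cons_append, strip_cons, if_pos hm, cyc_wd,
          List.append_nil, Cycle.coe_cons_eq_coe_append, ← hm]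
      · change (h : Fin n) = m at hm
        rw [List.map_cons, List.cons_append, List.cons_append, strip_cons, if_pos hm, cyc_wd]
        congr 1
        rw [Cycle.coe_eq_coe, List.map_append, List.map_cons, hm, List.append_assoc]
        refine List.isRotated_append.trans ?_
        rw [List.append_cons (List.map _ t) m]
        exact List.IsRotated.refl _
    · rw [if_neg hm, map_zero]
      rcases s with - | ⟨h, s⟩
      · change ¬ j = m at hm
        rw [List.map_nil, List.nil_append, List.cons_append, strip_cons, if_neg hm, map_zero]
      · change ¬ (h : Fin n) = m at hm
        rw [List.map_cons, List.cons_append, List.cons_append, strip_cons, if_neg hm, map_zero]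
  exact LinearMap.congr_fun this y

theorem tensorW_iota_adR_br (m : Fin n) {k : ℕ} (v : U j k) :
    tensorW (k + 2) (iota n (k + 1) (adR m k (br j k v))) =
      jW (zU k v) * wd [m] - wd [m] * jW (zU k v) := by
  have : tensorW (k + 2) ∘ₗ iota n (k + 1) ∘ₗ adR m k ∘ₗ br j k =
      LinearMap.mulRight ℤ (wd [m]) ∘ₗ jW ∘ₗ zU k - LinearMap.mulLeft ℤ (wd [m]) ∘ₗ jW ∘ₗ zU k := by
    refine Finsupp.lhom_ext' fun u => LinearMap.ext_ring ?_
    simp only [LinearMap.comp_apply, LinearMap.sub_apply, Finsupp.lsingle_apply, br_single,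
      zU_single, LinearMap.mulLeft_apply, LinearMap.mulRight_apply]
    rw [← bracket_snoc, tensorW_iota_bracket, bracket_snoc, iotaT_adR, map_sub, map_mul, map_mul,
      psi_ι, hW_x, psi_iotaT_bracket]
  exact LinearMap.congr_fun this v

/-- In `[c, x_m] = c x_m - x_m c` the second term contracts to `c`, which is cyclically zero by
`cyc_jW_zU`. -/
theorem cycC_Tr_conjDer (m : Fin n) {k : ℕ} (v : U j (k + 1)) :
    cycC (k + 2) (Tr n (k + 2) (conjDer m (k + 1) (br j (k + 1) v))) =
      Finsupp.lmapDomain ℤ ℤ (jCycle j) (wTr m (zU (k + 1) v)) := by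
  rw [Tr, LinearMap.comp_apply, cycC_mkQ, conjDer_apply, Phi_elem, tensorW_contract,
    tensorW_iota_adR_br, map_sub, map_sub, strip_wd_mul, if_pos rfl, cyc_jW_zU, sub_zero,
    cyc_strip_jW_mul]

/-- A power of `x_i` involves a single letter, whereas `x_j u` with `u` nonempty involves two. -/
theorem cycC_powSpan {k : ℕ} (u : Fin (k + 1) → Letter j) (y : C n (k + 2))
    (hy : y ∈ powSpan n (k + 2)) : cycC (k + 2) y (jCycle j (List.ofFn u)) = 0 := by
  induction hy using Submodule.span_induction with
  | zero => rw [map_zero]; rfl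
  | add a b _ _ ha hb => rw [map_add, Finsupp.add_apply, ha, hb, add_zero]
  | smul r a _ ha => rw [map_smul, Finsupp.smul_apply, ha, smul_zero]
  | mem y hy =>
    obtain ⟨i, rfl⟩ := hy
    have hpow : ∀ m : ℕ, (wd [i] : W n) ^ m = wd (List.replicate m i) := by
      intro m
      induction m with
      | zero => rfl
      | succ m ih => rw [pow_succ, ih, wd_mul, List.replicate_succ']
    rw [cycC_mkQ, tensorW_tprod, List.ofFn_const, List.prod_replicate, hW_x, hpow, cyc_wd,
      Finsupp.single_apply, if_neg]
    intro h
    have h' := Cycle.coe_eq_coe.mp h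
    have h1 := h'.mem_iff (a := j)
    have h2 := h'.mem_iff (a := (u 0 : Fin n))
    simp only [List.mem_replicate] at h1 h2
    have h3 : j = i := (h1.mpr (by simp)).2
    have h4 : (u 0 : Fin n) = i := (h2.mpr (by simp)).2
    exact (u 0).2 (h4.trans h3.symm)

theorem lmapDomain_wTr_zU {k : ℕ} (v : U j k) (u : Fin k → Letter j) :
    Finsupp.lmapDomain ℤ ℤ (jCycle j) (wTr j (zU k v)) (jCycle j (List.ofFn u)) = v u := by
  have : wTr j ∘ₗ zU (j := j) k = Finsupp.lmapDomain ℤ ℤ List.ofFn := by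
    refine Finsupp.lhom_ext' fun u => LinearMap.ext_ring ?_
    simp [zU_single, wTr_zWord]
  rw [show wTr j (zU k v) = Finsupp.lmapDomain ℤ ℤ List.ofFn v from LinearMap.congr_fun this v,
    Finsupp.lmapDomain_apply, Finsupp.lmapDomain_apply, Finsupp.mapDomain_apply jCycle_injective,
    Finsupp.mapDomain_apply List.ofFn_injective]

end TensorWords

/-! ## Elements of `𝔭_n(k, α)` -/

section Main

variable {n : ℕ} {j : Fin n}

theorem exists_eq_sum_conjDer {k : ℕ} {α : Fin n → ℕ} (hα : α j = 1) (X : p n (k + 1))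
    (hX : X ∈ pAlpha n (k + 1) α) :
    ∃ c : Fin n → U j k, (X : DerL n (k + 1)) = ∑ m, conjDer m k (br j k (c m)) := by
  induction hX using Submodule.span_induction with
  | zero => exact ⟨0, by simp⟩
  | add X Y _ _ hX hY =>
    obtain ⟨c, hc⟩ := hX
    obtain ⟨d, hd⟩ := hY
    exact ⟨c + d, by simp [hc, hd, Finset.sum_add_distrib]⟩
  | smul r X _ hX =>
    obtain ⟨c, hc⟩ := hX
    exact ⟨r • c, by simp only [Submodule.coe_smul, hc, Pi.smul_apply, map_smul, Finset.smul_sum]⟩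
  | mem X hX =>
    obtain ⟨i, w, hw, rfl⟩ := hX
    obtain ⟨v, hv⟩ := bracket_mem_range_br (j := j) k w ((hw j).trans hα)
    refine ⟨Pi.single i v, ?_⟩
    rw [Finset.sum_eq_single i]
    · rw [Pi.single_eq_same, hv, conjDer_apply, ← bracket_snoc]
      rfl
    · intro m _ hm
      rw [Pi.single_eq_of_ne hm, map_zero, map_zero]
    · simp

/-- In degree one the reduced trace carries no information, since the `x_i` span `𝓒_n(1)`; but there
`[x_j, x_j] = 0`. -/
theorem conjDer_br_zero (v : U j 0) : conjDer j 0 (br j 0 v) = 0 := by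
  have : conjDer j 0 ∘ₗ br j 0 = 0 := by
    refine Finsupp.lhom_ext' fun u => LinearMap.ext_ring ?_
    have h0 : adR j 0 (bracket n 0 (jWord j u)) = 0 := by
      rw [bracket, adR_cls]
      refine (cls_eq_zero_iff _).mpr ?_
      change ⁅FreeGroup.of j, FreeGroup.of j⁆ ∈ _
      rw [commutatorElement_self]
      exact Subgroup.one_mem _
    simp only [LinearMap.comp_apply, Finsupp.lsingle_apply, br_single, conjDer_apply, h0]
    exact LinearMap.ext fun y => smul_zero _
  exact LinearMap.congr_fun this v

theorem mem_imTauP_of_trBarP_eq_zero {k : ℕ} (hk : 1 ≤ k + 1) {α : Fin n → ℕ} (hα : α j = 1)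
    (X : p n (k + 1)) (hX : X ∈ pAlpha n (k + 1) α) (h0 : trBarP n (k + 1) X = 0) :
    (X : DerL n (k + 1)) ∈ imTauP n (k + 1) hk := by
  obtain ⟨c, hc⟩ := exists_eq_sum_conjDer hα X hX
  obtain ⟨v, hv, hv'⟩ := exists_sub_mem_imTauP k hk c
  suffices h : conjDer j k (br j k v) = 0 by
    rw [h, sub_zero, ← hc] at hv
    exact hv
  rcases k with - | k
  · exact conjDer_br_zero v
  · have hTr : Tr n (k + 2) X ∈ powSpan n (k + 2) := by
      rw [← Submodule.ker_mkQ (powSpan n (k + 2))]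
      exact h0
    have e : cycC (k + 2) (Tr n (k + 2) X) =
        Finsupp.lmapDomain ℤ ℤ (jCycle j) (wTr j (zU (k + 1) v)) := by
      rw [hc, ← hv', map_sum, map_sum, map_sum]
      exact Finset.sum_congr rfl fun m _ => cycC_Tr_conjDer m (c m)
    -- The coefficient of the cyclic word `x_j u` in the trace is `v u`, and the powers `x_i^(k+2)`
    -- do not contribute to it.
    have hv0 : v = 0 := by
      ext u
      rw [← lmapDomain_wTr_zU v u, ← e]
      exact cycC_powSpan u _ hTr
    rw [hv0, map_zero, map_zero]

end Main

end McCoolJohnson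

end

theorem mainTheorem2 (n k : ℕ) (hn : 3 ≤ n) (hk : 1 ≤ k) (α : Fin n → ℕ)
    (hα : ∑ j, α j = k) (hα1 : ∃ j, α j = 1) :
    (LinearMap.ker ((McCoolJohnson.trBarP n k).domRestrict (McCoolJohnson.pAlpha n k α))).map
        ((McCoolJohnson.p n k).subtype ∘ₗ (McCoolJohnson.pAlpha n k α).subtype) ≤
      McCoolJohnson.imTauP n k hk := by
  obtain ⟨j, hj⟩ := hα1
  obtain ⟨k, rfl⟩ : ∃ m, k = m + 1 := ⟨k - 1, by omega⟩
  rintro _ ⟨X, hX, rfl⟩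
  exact McCoolJohnson.mem_imTauP_of_trBarP_eq_zero hk hj X.1 X.2 hX
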